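/- For $C\subseteq\mathbb N$, a function $g:\mathbb N\to\mathbb N$ is $C$-hyperimmune if no $C$-computable function $h:\mathbb N\to\mathbb N$ dominates it (i.e. satisfies $g(x)\le h(x)$ for all $x$), and a set $A\subseteq\mathbb N$ is $C$-hyperimmune if it is infinite and its principal function $p_A$ (the increasing enumeration of $A$) is $C$-hyperimmune. A function $f:\mathbb N\to\mathbb N$ is $C$-computably bounded if it is dominated by a $C$-computable function, and eventually increasing if $f^{-1}(\{y\})$ is finite for every $y\in\mathbb N$. A non-decreasing subsequence for $f$ is a set $G\subseteq\mathbb N$ such that $f(x)\le f(y)$ for all $x<y$ in $G$. A problem $\mathsf P$ (a class of instances, each with a class of solutions) admits preservation of hyperimmunity if for every set $C$, every sequence $A_0,A_1,\dots$ of $C$-hyperimmune sets and every instance $X\le_T C$ of $\mathsf P$, there is a solution $Y$ to $X$ such that every $A_i$ is $Y\oplus C$-hyperimmune. Consider the following two problems. - $\mathsf{ICNS}$: an instance is a pair $(g,b)$ of functions $g:\mathbb N\times\mathbb N\to\mathbb N$ and $b:\mathbb N\to\mathbb N$ such that $\tilde g(x)=\lim_s g(x,s)$ exists and $\tilde g(x)\le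 b(x)$ for every $x$, and $\tilde g$ is eventually increasing; a solution is an infinite non-decreasing subsequence for $\tilde g$. - $\mathsf{LNS}$: an instance is a function $g:\mathbb N\times\mathbb N\to\mathbb N$ such that $g(x,s+1)\le g(x,s)$ for all $x,s$; a solution is an infinite non-decreasing subsequence for $\tilde g(x)=\lim_s g(x,s)$. **Theorem.** (1) Let $C\subseteq\mathbb N$ and let $A_0,A_1,\dots$ be a sequence of $C$-hyperimmune sets. For every $C$-computably bounded, eventually increasing function $f:\mathbb N\to\mathbb N$, there is an infinite non-decreasing subsequence $G$ for $f$ such that every $A_i$ is $G\oplus C$-hyperimmune. (2) $\mathsf{ICNS}$ admits preservation of hyperimmunity. (3) $\mathsf{LNS}$ admits preservation of hyperimmunity. -/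

import Mathlib

namespace NonDecr

open Classical in
/-- The characteristic function of a set of natural numbers, as an oracle. -/
noncomputable def oracle (C : Set ℕ) : ℕ →. ℕ :=
  fun n => Part.some (if n ∈ C then 1 else 0)

/-- `f ≤_T C`: the total function `f : ℕ → ℕ` is computable with oracle `C`. -/
def ComputableFrom (C : Set ℕ) (f : ℕ → ℕ) : Prop :=
  ComputableIn {oracle C} f

/-- The effective join `A ⊕ B = {2n : n ∈ A} ∪ {2n + 1 : n ∈ B}`. -/
def join (A B : Set ℕ) : Set ℕ :=
  (fun n => 2 * n) '' A ∪ (fun n => 2 * n + 1) '' B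

/-- `f` is dominated by `g`: `f x ≤ g x` for every `x`. (Asking this for almost all `x` only
gives the same notions below, as these are closed under finite changes of `g`.) -/
def DominatedBy (f g : ℕ → ℕ) : Prop :=
  ∀ x, f x ≤ g x

/-- `f` is `C`-computably bounded: it is dominated by a `C`-computable function. -/
def ComputablyBounded (C : Set ℕ) (f : ℕ → ℕ) : Prop :=
  ∃ b : ℕ → ℕ, ComputableFrom C b ∧ DominatedBy f b

/-- `f` is a `C`-hyperimmune function: it is not dominated by any `C`-computable function. -/
def HyperimmuneFun (C : Set ℕ) (f : ℕ → ℕ) : Prop :=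
  ∀ g : ℕ → ℕ, ComputableFrom C g → ¬ DominatedBy f g

/-- The principal function of `A = {a₀ < a₁ < ⋯}`, namely `n ↦ aₙ` (meaningful for infinite `A`). -/
noncomputable def principalFun (A : Set ℕ) : ℕ → ℕ :=
  Nat.nth (fun x => x ∈ A)

/-- `A` is a `C`-hyperimmune set: it is infinite and its principal function is `C`-hyperimmune. -/
def Hyperimmune (C A : Set ℕ) : Prop :=
  A.Infinite ∧ HyperimmuneFun C (principalFun A)

/-- `f` is eventually increasing: each value has only finitely many predecessors. -/
def EventuallyIncreasing (f : ℕ → ℕ) : Prop :=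
  ∀ y, {x | f x = y}.Finite

/-- `G` is an infinite non-decreasing subsequence for `f`. -/
def IsInfNonDecreasing (f : ℕ → ℕ) (G : Set ℕ) : Prop :=
  G.Infinite ∧ ∀ x ∈ G, ∀ y ∈ G, x < y → f x ≤ f y

/-- `f` is the limit function of `g : ℕ × ℕ → ℕ`, that is, `f x = lim_s g (x, s)` for all `x`
(the limit in the discrete space `ℕ`, so that `g (x, ·)` is eventually constant). -/
def IsLimitFun (g : ℕ → ℕ → ℕ) (f : ℕ → ℕ) : Prop :=
  ∀ x, ∀ᶠ s in Filter.atTop, g x s = f x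

/-- A problem: a collection of instances, and for each instance its solutions. Instances are
points of Baire space; solutions are sets of natural numbers. -/
structure Problem where
  /-- The instances. -/
  Inst : Set (ℕ → ℕ)
  /-- `Sol X Y`: the set `Y` is a solution to the instance `X`. -/
  Sol : (ℕ → ℕ) → Set ℕ → Prop

/-- Preservation of hyperimmunity: whenever `A₀, A₁, …` are `C`-hyperimmune and `X ≤_T C` is an
instance, there is a solution `Y` to `X` such that all `Aᵢ` are `Y ⊕ C`-hyperimmune. -/
def Problem.PreservesHyperimmunity (P : Problem) : Prop :=
  ∀ (C : Set ℕ) (A : ℕ → Set ℕ), (∀ i, Hyperimmune C (A i)) →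
    ∀ X ∈ P.Inst, ComputableFrom C X →
      ∃ Y : Set ℕ, P.Sol X Y ∧ ∀ i, Hyperimmune (join Y C) (A i)

/-- The binary function coded by `X`. -/
def binary (X : ℕ → ℕ) (x s : ℕ) : ℕ :=
  X (Nat.pair x s)

/-- The left half of `X`, where `X = X₀ ⊕ X₁` codes a pair of functions. -/
def left (X : ℕ → ℕ) (n : ℕ) : ℕ :=
  X (2 * n)

/-- The right half of `X`, where `X = X₀ ⊕ X₁` codes a pair of functions. -/
def right (X : ℕ → ℕ) (n : ℕ) : ℕ :=
  X (2 * n + 1)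

/-- `CNS`: every computably bounded `Δ⁰₂` function has an infinite non-decreasing subsequence.
An instance is (a code of) a pair of a `Δ⁰₂` approximation `g : ℕ × ℕ → ℕ` of a function `f`
and a function `b` dominating `f`. So the `C`-computable instances present the `Δ⁰₂(C)`
functions that are `C`-computably bounded. -/
def CNS : Problem where
  Inst := {X | ∃ f, IsLimitFun (binary (left X)) f ∧ DominatedBy f (right X)}
  Sol X Y := ∃ f, IsLimitFun (binary (left X)) f ∧ IsInfNonDecreasing f Y

/-- `ICNS`: the restriction of `CNS` to eventually increasing functions. -/
def ICNS : Problem where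
  Inst := {X | X ∈ CNS.Inst ∧ ∃ f, IsLimitFun (binary (left X)) f ∧ EventuallyIncreasing f}
  Sol := CNS.Sol

/-- `LNS`: every `f : ℕ × ℕ → ℕ` with `f (x, s + 1) ≤ f (x, s)` for all `x` and `s` has an infinite
limit non-decreasing subsequence, i.e. one for its limit function. -/
def LNS : Problem where
  Inst := {X | ∀ x s, binary X x (s + 1) ≤ binary X x s}
  Sol X Y := ∃ f, IsLimitFun (binary X) f ∧ IsInfNonDecreasing f Y

end NonDecr

/-! Part (1) is a forcing argument. A condition is a finite stem on which `f` is non-decreasing,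
also towards the reservoir, with an infinite reservoir computable in an oracle `Z` such that every
`Z`-computable function is dominated by a `C`-computable one. Since `f` need not be computable, it
is replaced by all functions `g ≤ b`, where `b` is a computable bound of `f`; they form an
effectively compact class.

To keep a computation `h` from dominating a hyperimmune `a`, ask whether for every input `x` and
every `g ≤ b` some finite extension of the stem inside the reservoir, non-decreasing for `g`, makes
the computation converge. If so, effective compactness (`exists_red_bound`) bounds the length of
such an extension, and with it the value of `h`, uniformly in `g` and computably in `Z`, hence below
a `C`-computable function. That function is below `a` at some `x`; taking `g = f` gives an extension
of the stem that forces `h x < a x`. If not, some `x` admits a nonempty effectively closed class of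
counterexamples `g`. The computably dominated basis theorem (`exists_dominatedOver_mem`) picks one
whose join with the oracle is still dominated over `C`; thinning the reservoir to a set where this
`g` is non-decreasing forces divergence at `x`. Eventual increase of `f` lets any finite extension
of the stem be completed by a tail of the reservoir.

Part (2) is a direct application. In part (3), `g (x, 0)` bounds the limit; if the limit is not
eventually increasing, a computable solution exists on which the limit is constant. -/

theorem PrimrecPred.ball_mem {α β : Type*} [Primcodable α] [Primcodable β] {f : α → List β}
    {p : α → β → Prop} (hf : Primrec f) (hp : PrimrecRel p) :
    PrimrecPred fun a => ∀ x ∈ f a, p a x :=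
  (PrimrecRel.forall_mem_list (R := fun x a => p a x) hp.swap).comp hf Primrec.id

theorem PrimrecPred.bex_mem {α β : Type*} [Primcodable α] [Primcodable β] {f : α → List β}
    {p : α → β → Prop} (hf : Primrec f) (hp : PrimrecRel p) :
    PrimrecPred fun a => ∃ x ∈ f a, p a x :=
  (PrimrecRel.exists_mem_list (R := fun x a => p a x) hp.swap).comp hf Primrec.id

theorem PrimrecPred.ball_lt {α : Type*} [Primcodable α] {f : α → ℕ}
    {p : α → ℕ → Prop} (hf : Primrec f) (hp : PrimrecRel p) :
    PrimrecPred fun a => ∀ x < f a, p a x :=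
  (PrimrecPred.ball_mem (Primrec.list_range.comp hf) hp).of_eq fun a => by simp

theorem PrimrecPred.bex_lt {α : Type*} [Primcodable α] {f : α → ℕ}
    {p : α → ℕ → Prop} (hf : Primrec f) (hp : PrimrecRel p) :
    PrimrecPred fun a => ∃ x < f a, p a x :=
  (PrimrecPred.bex_mem (Primrec.list_range.comp hf) hp).of_eq fun a => by simp

/-! ### The use principle for oracle computations -/

namespace NonDecr

/-- The initial segment of length `n` of `o`. -/
def seg (o : ℕ → ℕ) (n : ℕ) : List ℕ :=
  (List.range n).map o

@[simp] theorem length_seg (o : ℕ → ℕ) (n : ℕ) : (seg o n).length = n := by simp [seg]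

theorem getElem?_seg (o : ℕ → ℕ) (n i : ℕ) :
    (seg o n)[i]? = if i < n then some (o i) else none := by
  by_cases h : i < n <;> simp [seg, h]

theorem getD_seg {o : ℕ → ℕ} {n i : ℕ} (h : i < n) (d : ℕ) : (seg o n).getD i d = o i := by
  rw [List.getD_eq_getElem?_getD, getElem?_seg, if_pos h, Option.getD_some]

theorem take_seg (o : ℕ → ℕ) {j n : ℕ} (h : j ≤ n) : (seg o n).take j = seg o j := by
  simp [seg, ← List.map_take, List.take_range, h]

theorem seg_congr {o o' : ℕ → ℕ} {n : ℕ} (h : ∀ i < n, o i = o' i) : seg o n = seg o' n := by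
  simpa [seg] using h

theorem map_seg (p o : ℕ → ℕ) (n : ℕ) : (seg o n).map p = seg (fun i => p (o i)) n := by
  simp [seg, Function.comp_def]

/-- `Φ` approximates the partial function `f` along the initial segments of `o`. -/
structure Approximates (o : ℕ → ℕ) (f : ℕ →. ℕ) (Φ : List ℕ → ℕ → Option ℕ) : Prop where
  primrec : Primrec₂ Φ
  mono : ∀ {n m x v}, n ≤ m → Φ (seg o n) x = some v → Φ (seg o m) x = some v
  mem_iff : ∀ x v, v ∈ f x ↔ ∃ n, Φ (seg o n) x = some v

theorem approximates_of_primrec (o : ℕ → ℕ) {f : ℕ → ℕ} (hf : Primrec f) :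
    Approximates o (fun n => Part.some (f n)) fun _ x => some (f x) where
  primrec := (Primrec.option_some.comp (hf.comp Primrec.snd)).to₂
  mono := fun _ h => h
  mem_iff := fun x v => by simp [eq_comm]

theorem approximates_oracle (o : ℕ → ℕ) :
    Approximates o (fun n => Part.some (o n)) fun σ x => σ[x]? where
  primrec := Primrec.list_getElem?
  mono := fun {n m x v} h => by
    simp only [getElem?_seg]
    split_ifs <;> first | omega | simp
  mem_iff := fun x v => by
    simp only [getElem?_seg, Part.mem_some_iff]
    constructor
    · rintro rfl; exact ⟨x + 1, by simp⟩
    · rintro ⟨n, h⟩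
      split_ifs at h
      simpa [eq_comm] using h

variable {o : ℕ → ℕ} {f g : ℕ →. ℕ} {Φ Ψ : List ℕ → ℕ → Option ℕ}

theorem Approximates.pair (hf : Approximates o f Φ) (hg : Approximates o g Ψ) :
    Approximates o (fun n => Nat.pair <$> f n <*> g n)
      fun σ x => (Φ σ x).bind fun a => (Ψ σ x).map fun b => Nat.pair a b where
  primrec := by
    refine (Primrec.option_bind (g := fun (q : List ℕ × ℕ) (a : ℕ) =>
      (Ψ q.1 q.2).map fun b => Nat.pair a b) (hf.primrec.comp Primrec.fst Primrec.snd) ?_).to₂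
    exact (Primrec.option_map (g := fun (q : (List ℕ × ℕ) × ℕ) (b : ℕ) => Nat.pair q.2 b)
      (hg.primrec.comp (Primrec.fst.comp Primrec.fst) (Primrec.snd.comp Primrec.fst))
      (Primrec₂.natPair.comp (Primrec.snd.comp Primrec.fst) Primrec.snd).to₂).to₂
  mono := by
    intro n m x v h
    simp only [Option.bind_eq_some_iff, Option.map_eq_some_iff]
    rintro ⟨a, ha, b, hb, rfl⟩
    exact ⟨a, hf.mono h ha, b, hg.mono h hb, rfl⟩
  mem_iff := by
    intro x v
    simp only [Seq.seq, Part.map_eq_map, Part.mem_bind_iff, Part.mem_map_iff,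
      Option.bind_eq_some_iff, Option.map_eq_some_iff, hf.mem_iff, hg.mem_iff]
    constructor
    · rintro ⟨_, ⟨a, ⟨n, ha⟩, rfl⟩, b, ⟨m, hb⟩, rfl⟩
      exact ⟨max n m, a, hf.mono (le_max_left _ _) ha, b, hg.mono (le_max_right _ _) hb, rfl⟩
    · rintro ⟨n, a, ha, b, hb, rfl⟩
      exact ⟨_, ⟨a, ⟨n, ha⟩, rfl⟩, b, ⟨n, hb⟩, rfl⟩

theorem Approximates.comp (hf : Approximates o f Φ) (hg : Approximates o g Ψ) :
    Approximates o (fun n => g n >>= f) fun σ x => (Ψ σ x).bind fun a => Φ σ a where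
  primrec :=
    (Primrec.option_bind (hg.primrec.comp Primrec.fst Primrec.snd)
      (hf.primrec.comp (Primrec.fst.comp Primrec.fst) Primrec.snd).to₂).to₂
  mono := by
    intro n m x v h
    simp only [Option.bind_eq_some_iff]
    rintro ⟨a, ha, hb⟩
    exact ⟨a, hg.mono h ha, hf.mono h hb⟩
  mem_iff := by
    intro x v
    refine Part.mem_bind_iff.trans ?_
    simp only [Option.bind_eq_some_iff, hf.mem_iff, hg.mem_iff]
    constructor
    · rintro ⟨a, ⟨n, ha⟩, m, hb⟩
      exact ⟨max n m, a, hg.mono (le_max_left _ _) ha, hf.mono (le_max_right _ _) hb⟩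
    · rintro ⟨n, a, ha, hb⟩
      exact ⟨a, ⟨n, ha⟩, n, hb⟩

theorem Approximates.prec (hf : Approximates o f Φ) (hg : Approximates o g Ψ) :
    Approximates o
      (fun p => let (a, n) := Nat.unpair p
        n.rec (f a) fun y IH => do
          let i ← IH
          g (Nat.pair a (Nat.pair y i)))
      fun σ p => p.unpair.2.rec (Φ σ p.unpair.1) fun y IH =>
        IH.bind fun i => Ψ σ (Nat.pair p.unpair.1 (Nat.pair y i)) where
  primrec := by
    refine (Primrec.nat_rec' (f := fun q : List ℕ × ℕ => q.2.unpair.2)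
      (g := fun q : List ℕ × ℕ => Φ q.1 q.2.unpair.1)
      (h := fun (q : List ℕ × ℕ) (r : ℕ × Option ℕ) =>
        r.2.bind fun i => Ψ q.1 (Nat.pair q.2.unpair.1 (Nat.pair r.1 i))) ?_ ?_ ?_).to₂
    · exact Primrec.snd.comp (Primrec.unpair.comp Primrec.snd)
    · exact hf.primrec.comp Primrec.fst (Primrec.fst.comp (Primrec.unpair.comp Primrec.snd))
    · refine (Primrec.option_bind (f := fun q : (List ℕ × ℕ) × ℕ × Option ℕ => q.2.2)
        (g := fun (q : (List ℕ × ℕ) × ℕ × Option ℕ) (i : ℕ) =>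
          Ψ q.1.1 (Nat.pair q.1.2.unpair.1 (Nat.pair q.2.1 i)))
        (Primrec.snd.comp Primrec.snd) ?_).to₂
      have h := Primrec.fst (α := (List ℕ × ℕ) × ℕ × Option ℕ) (β := ℕ)
      exact (hg.primrec.comp (Primrec.fst.comp (Primrec.fst.comp h))
        (Primrec₂.natPair.comp
          (Primrec.fst.comp (Primrec.unpair.comp (Primrec.snd.comp (Primrec.fst.comp h))))
          (Primrec₂.natPair.comp (Primrec.fst.comp (Primrec.snd.comp h)) Primrec.snd))).to₂
  mono := by
    intro n m x v h
    generalize x.unpair.2 = k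
    induction k generalizing v with
    | zero => exact hf.mono h
    | succ k ih =>
      simp only [Option.bind_eq_some_iff]
      rintro ⟨a, ha, hb⟩
      exact ⟨a, ih ha, hg.mono h hb⟩
  mem_iff := by
    have hmono : ∀ {n m a k v}, n ≤ m →
        (Nat.rec (Φ (seg o n) a) (fun y IH => IH.bind fun i =>
          Ψ (seg o n) (Nat.pair a (Nat.pair y i))) k : Option ℕ) = some v →
        (Nat.rec (Φ (seg o m) a) (fun y IH => IH.bind fun i =>
          Ψ (seg o m) (Nat.pair a (Nat.pair y i))) k : Option ℕ) = some v := by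
      intro n m a k v h
      induction k generalizing v with
      | zero => exact hf.mono h
      | succ k ih =>
        simp only [Option.bind_eq_some_iff]
        rintro ⟨a, ha, hb⟩
        exact ⟨a, ih ha, hg.mono h hb⟩
    intro x v
    dsimp only
    generalize x.unpair.1 = a
    generalize x.unpair.2 = k
    induction k generalizing v with
    | zero => exact hf.mem_iff a v
    | succ k ih =>
      refine Part.mem_bind_iff.trans ?_
      simp only [Option.bind_eq_some_iff, ih, hg.mem_iff]
      constructor
      · rintro ⟨i, ⟨n, hn⟩, m, hm⟩
        exact ⟨max n m, i, hmono (le_max_left _ _) hn, hg.mono (le_max_right _ _) hm⟩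
      · rintro ⟨n, i, hn, hm⟩
        exact ⟨i, ⟨n, hn⟩, n, hm⟩

/-- On the value table `Φ σ`, unbounded search with parameter `a` stops at `k`. -/
def StopsAt (Φ : List ℕ → ℕ → Option ℕ) (q : List ℕ × ℕ) (k : ℕ) : Prop :=
  Φ q.1 (Nat.pair q.2 k) = some 0 ∧
    ∀ m < k, Φ q.1 (Nat.pair q.2 m) ≠ none ∧ Φ q.1 (Nat.pair q.2 m) ≠ some 0

theorem StopsAt.unique {q : List ℕ × ℕ} {k l : ℕ} (hk : StopsAt Φ q k) (hl : StopsAt Φ q l) :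
    k = l := by
  rcases lt_trichotomy k l with h | h | h
  · exact absurd hk.1 (hl.2 k h).2
  · exact h
  · exact absurd hl.1 (hk.2 l h).2

theorem primrecRel_stopsAt (hΦ : Primrec₂ Φ) : PrimrecRel (StopsAt Φ) := by
  have key : Primrec₂ fun (q : (List ℕ × ℕ) × ℕ) (m : ℕ) => Φ q.1.1 (Nat.pair q.1.2 m) :=
    (hΦ.comp (Primrec.fst.comp (Primrec.fst.comp Primrec.fst))
      (Primrec₂.natPair.comp (Primrec.snd.comp (Primrec.fst.comp Primrec.fst)) Primrec.snd)).to₂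
  refine PrimrecPred.and ?_ (PrimrecPred.ball_lt Primrec.snd (PrimrecPred.and ?_ ?_))
  · exact Primrec.eq.comp (key.comp Primrec.id Primrec.snd) (Primrec.const (some 0))
  · exact (Primrec.eq.comp key (Primrec.const none)).not
  · exact (Primrec.eq.comp key (Primrec.const (some 0))).not

open Classical in
/-- Unbounded search, cut off at the length of the oracle segment. -/
noncomputable def searchApprox (Φ : List ℕ → ℕ → Option ℕ) (σ : List ℕ) (a : ℕ) : Option ℕ :=
  ((List.range σ.length).filterMap fun k => if StopsAt Φ (σ, a) k then some k else none).head?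

theorem searchApprox_eq_some {σ : List ℕ} {a k : ℕ} :
    searchApprox Φ σ a = some k ↔ k < σ.length ∧ StopsAt Φ (σ, a) k := by
  classical
  have key : ∀ l, l ∈ ((List.range σ.length).filterMap fun k =>
      if StopsAt Φ (σ, a) k then some k else none) ↔ l < σ.length ∧ StopsAt Φ (σ, a) l := by
    intro l
    simp [List.mem_filterMap]
  constructor
  · intro h
    exact (key k).1 (List.mem_of_mem_head? h)
  · intro h
    have hmem := (key k).2 h
    obtain ⟨l, hl⟩ : ∃ l, searchApprox Φ σ a = some l := by
      rw [← Option.isSome_iff_exists, searchApprox, List.isSome_head?]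
      simpa using List.ne_nil_of_mem hmem
    rw [hl, ((key l).1 (List.mem_of_mem_head? hl)).2.unique h.2]

/-- Monotonicity holds because `StopsAt` asks for all earlier values to be already defined: a longer
segment cannot reveal an earlier zero. -/
theorem Approximates.rfind (hf : Approximates o f Φ) :
    Approximates o (fun a => Nat.rfind fun n => (fun m => decide (m = 0)) <$> f (Nat.pair a n))
      (searchApprox Φ) := by
  classical
  have hmono : ∀ {n m a k}, n ≤ m → StopsAt Φ (seg o n, a) k → StopsAt Φ (seg o m, a) k := by
    rintro n m a k h ⟨h0, h1⟩
    refine ⟨hf.mono h h0, fun j hj => ?_⟩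
    obtain ⟨v, hv⟩ := Option.ne_none_iff_exists'.1 (h1 j hj).1
    have h2 := (h1 j hj).2
    simp only at hv h2 ⊢
    rw [hf.mono h hv, ← hv]
    exact ⟨by simp [hv], h2⟩
  refine ⟨?_, ?_, ?_⟩
  · refine (Primrec.list_head?.comp (Primrec.listFilterMap
      (f := fun q : List ℕ × ℕ => List.range q.1.length)
      (g := fun (q : List ℕ × ℕ) (k : ℕ) => if StopsAt Φ q k then some k else none)
      (Primrec.list_range.comp (Primrec.list_length.comp Primrec.fst)) ?_)).to₂
    exact Primrec.ite (c := fun p : (List ℕ × ℕ) × ℕ => StopsAt Φ p.1 p.2)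
      (primrecRel_stopsAt hf.primrec)
      (Primrec.option_some.comp Primrec.snd) (Primrec.const none)
  · intro n m x v h
    simp only [searchApprox_eq_some, length_seg]
    exact fun ⟨h1, h2⟩ => ⟨h1.trans_le h, hmono h h2⟩
  · intro x v
    refine Nat.mem_rfind.trans ?_
    simp only [searchApprox_eq_some, length_seg, Part.map_eq_map, Part.mem_map_iff,
      decide_eq_true_eq, decide_eq_false_iff_not, hf.mem_iff]
    constructor
    · rintro ⟨⟨_, ⟨n, hn⟩, rfl⟩, h⟩
      have h' : ∀ m, ∃ n, m < v → ∃ a ≠ 0, Φ (seg o n) (Nat.pair x m) = some a := by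
        intro m
        by_cases hm : m < v
        · obtain ⟨a, ⟨n, hn⟩, ha⟩ := h hm
          exact ⟨n, fun _ => ⟨a, ha, hn⟩⟩
        · exact ⟨0, fun h => absurd h hm⟩
      choose N hN using h'
      -- The segment must be longer than the answer `v`, because of the cut-off, and must cover the
      -- uses of all values at or below `v`.
      refine ⟨max (v + 1) (max n ((Finset.range v).sup N)), by omega, ?_, fun m hm => ?_⟩
      · exact hf.mono (by omega) hn
      · obtain ⟨a, ha, hΦ⟩ := hN m hm
        have hle : N m ≤ (Finset.range v).sup N := Finset.le_sup (Finset.mem_range.2 hm)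
        simp only
        rw [hf.mono (m := max (v + 1) (max n ((Finset.range v).sup N))) (by omega) hΦ]
        simpa using ha
    · rintro ⟨n, -, h0, h1⟩
      refine ⟨⟨0, ⟨n, h0⟩, rfl⟩, fun {m} hm => ?_⟩
      obtain ⟨a, ha⟩ := Option.ne_none_iff_exists'.1 (h1 m hm).1
      refine ⟨a, ⟨n, ha⟩, ?_⟩
      rintro rfl
      exact (h1 m hm).2 ha

/-- The use principle: a function recursive in `o` is approximated by a primitive recursive
functional reading initial segments of `o`. -/
theorem exists_approximates (hf : Nat.RecursiveIn {fun n => Part.some (o n)} f) :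
    ∃ Φ, Approximates o f Φ := by
  induction hf with
  | zero => exact ⟨_, approximates_of_primrec o (Primrec.const 0)⟩
  | succ => exact ⟨_, approximates_of_primrec o Primrec.succ⟩
  | left => exact ⟨_, approximates_of_primrec o (Primrec.fst.comp Primrec.unpair)⟩
  | right => exact ⟨_, approximates_of_primrec o (Primrec.snd.comp Primrec.unpair)⟩
  | oracle g hg =>
    rw [Set.mem_singleton_iff.1 hg]
    exact ⟨_, approximates_oracle o⟩
  | pair _ _ ihf ihg =>
    obtain ⟨_, hf⟩ := ihf
    obtain ⟨_, hg⟩ := ihg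
    exact ⟨_, hf.pair hg⟩
  | comp _ _ ihf ihg =>
    obtain ⟨_, hf⟩ := ihf
    obtain ⟨_, hg⟩ := ihg
    exact ⟨_, hf.comp hg⟩
  | prec _ _ ihf ihg =>
    obtain ⟨_, hf⟩ := ihf
    obtain ⟨_, hg⟩ := ihg
    exact ⟨_, hf.prec hg⟩
  | rfind _ ihf =>
    obtain ⟨_, hf⟩ := ihf
    exact ⟨_, hf.rfind⟩


/-! ### Relative computability of total functions -/

open Encodable Denumerable

/-- The total function `f` is recursive in the total function `o`. -/
def Red (o f : ℕ → ℕ) : Prop :=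
  Nat.RecursiveIn {fun n => Part.some (o n)} fun n => Part.some (f n)

/-- The function coding the pair `(f, g)`. -/
def pairFun (f g : ℕ → ℕ) (n : ℕ) : ℕ :=
  Nat.pair (f n) (g n)

namespace Red

variable {o f g h : ℕ → ℕ}

protected theorem refl (o : ℕ → ℕ) : Red o o :=
  .oracle _ rfl

theorem trans (hf : Red o f) (hg : Red f g) : Red o g :=
  Nat.RecursiveIn.subst hg fun k hk => by rwa [Set.mem_singleton_iff.1 hk]

theorem of_eq (hf : Red o f) (H : ∀ n, f n = g n) : Red o g :=
  funext H ▸ hf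

theorem of_primrec (o : ℕ → ℕ) (hf : Primrec f) : Red o f :=
  (Primrec.nat_iff.1 hf).recursiveIn

theorem comp (hf : Red o f) (hg : Red o g) : Red o fun n => f (g n) :=
  (Nat.RecursiveIn.comp hf hg).of_eq fun _ => Part.bind_some _ _

theorem pair (hf : Red o f) (hg : Red o g) : Red o (pairFun f g) :=
  (Nat.RecursiveIn.pair hf hg).of_eq fun n => by simp [Seq.seq, pairFun]

theorem primrec_comp {p : ℕ → ℕ} (hp : Primrec p) (hf : Red o f) : Red o fun n => p (f n) :=
  (of_primrec o hp).comp hf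

theorem primrec_comp₂ {p : ℕ → ℕ → ℕ} (hp : Primrec₂ p) (hf : Red o f) (hg : Red o g) :
    Red o fun n => p (f n) (g n) :=
  (primrec_comp (p := fun n => p n.unpair.1 n.unpair.2)
    (hp.comp (Primrec.fst.comp Primrec.unpair) (Primrec.snd.comp Primrec.unpair))
    (hf.pair hg)).of_eq fun n => by simp [pairFun]

theorem id (o : ℕ → ℕ) : Red o id :=
  of_primrec o Primrec.id

theorem prec (hf : Red o f) (hg : Red o g) :
    Red o fun p => p.unpair.2.rec (f p.unpair.1) fun y i =>
      g (Nat.pair p.unpair.1 (Nat.pair y i)) :=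
  (Nat.RecursiveIn.prec hf hg).of_eq fun p => by
    dsimp only
    induction p.unpair.2 with
    | zero => rfl
    | succ k ih => exact (congrArg (fun t => Part.bind t _) ih).trans (Part.bind_some _ _)

theorem rfind (hf : Red o f) (h : ∀ a, ∃ n, f (Nat.pair a n) = 0) :
    ∃ m, Red o m ∧ ∀ a, f (Nat.pair a (m a)) = 0 := by
  classical
  refine ⟨fun a => Nat.find (h a), (Nat.RecursiveIn.rfind hf).of_eq_tot fun a => ?_,
    fun a => Nat.find_spec (h a)⟩
  refine Nat.mem_rfind.2 ⟨?_, fun {m} hm => ?_⟩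
  · simpa using Nat.find_spec (h a)
  · simpa using Nat.find_min (h a) hm

theorem encode_seg (o : ℕ → ℕ) : Red o fun n => encode (seg o n) := by
  have hstep : Red o fun p => encode (ofNat (List ℕ) p.unpair.2.unpair.2 ++
      [o p.unpair.2.unpair.1]) := by
    have hsnd := Primrec.snd.comp (Primrec.unpair.comp (Primrec.snd.comp Primrec.unpair))
    have hfst := Primrec.fst.comp (Primrec.unpair.comp (Primrec.snd.comp Primrec.unpair))
    refine primrec_comp₂ (p := fun l x => encode (ofNat (List ℕ) l ++ [x])) ?_
      (of_primrec o hsnd) ((Red.refl o).comp (of_primrec o hfst))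
    exact (Primrec.encode.comp (Primrec.list_concat.comp
      ((Primrec.ofNat (List ℕ)).comp Primrec.fst) Primrec.snd)).to₂
  have h := (prec (of_primrec o (Primrec.const (encode ([] : List ℕ)))) hstep).comp
    (of_primrec o (Primrec₂.natPair.comp (Primrec.const 0) Primrec.id))
  refine h.of_eq fun n => ?_
  simp only [Nat.unpair_pair, id_eq]
  induction n with
  | zero => rfl
  | succ n ih => simp only [ih, ofNat_encode, seg, List.range_succ, List.map_append, List.map_cons,
      List.map_nil]

/-- A function computed from a computable initial segment of `o` is recursive in `o`. -/
theorem of_seg {F : List ℕ → ℕ → ℕ} (hF : Primrec₂ F) {l : ℕ → ℕ} (hl : Red o l) :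
    Red o fun x => F (seg o (l x)) x :=
  (primrec_comp₂ (p := fun s x => F (ofNat (List ℕ) s) x)
    (hF.comp ((Primrec.ofNat (List ℕ)).comp Primrec.fst) Primrec.snd).to₂
    ((encode_seg o).comp hl) (Red.id o)).of_eq fun n => by simp

theorem search {θ : List ℕ → ℕ → Prop} (hθ : PrimrecRel θ) (h : ∀ x, ∃ n, θ (seg o n) x) :
    ∃ m, Red o m ∧ ∀ x, θ (seg o (m x)) x := by
  classical
  have hp : Primrec₂ fun (s : List ℕ) (p : ℕ) => if θ s p.unpair.1 then 0 else 1 :=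
    Primrec.ite (c := fun q : List ℕ × ℕ => θ q.1 q.2.unpair.1)
      (hθ.comp Primrec.fst (Primrec.fst.comp (Primrec.unpair.comp Primrec.snd)))
      (Primrec.const 0) (Primrec.const 1)
  obtain ⟨m, hm, h⟩ := rfind (of_seg hp (of_primrec o (Primrec.snd.comp Primrec.unpair)))
    (fun a => by simpa using h a)
  exact ⟨m, hm, fun x => by simpa using h x⟩

/-- Every function recursive in `o` is bounded by the length of the initial segment of `o` on which
some primitive recursive relation holds. -/
theorem exists_bounding_rel (hh : Red o h) : ∃ θ : List ℕ → ℕ → Prop, PrimrecRel θ ∧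
    (∀ x, ∃ n, θ (seg o n) x) ∧ ∀ x n, θ (seg o n) x → h x ≤ n := by
  obtain ⟨Φ, hΦ⟩ := exists_approximates hh
  -- Asking for a value at most the length of the segment makes a single number bound both the use
  -- and the value.
  refine ⟨fun σ x => ∃ v < σ.length + 1, Φ σ x = some v, ?_, fun x => ?_, ?_⟩
  · refine PrimrecPred.bex_lt (Primrec.succ.comp (Primrec.list_length.comp Primrec.fst)) ?_
    exact Primrec.eq.comp (hΦ.primrec.comp (Primrec.fst.comp Primrec.fst)
      (Primrec.snd.comp Primrec.fst)) (Primrec.option_some.comp Primrec.snd)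
  · obtain ⟨n, hn⟩ := (hΦ.mem_iff x (h x)).1 (Part.mem_some _)
    exact ⟨max n (h x), h x, by simp, hΦ.mono (le_max_left _ _) hn⟩
  · rintro x n ⟨v, hv, h1⟩
    have := Part.mem_some_iff.1 ((hΦ.mem_iff x v).2 ⟨n, h1⟩)
    simp only [length_seg] at hv
    omega

end Red

/-- There is an enumeration of all primitive recursive relations between strings and numbers. -/
theorem exists_enum_primrecRel : ∃ e : ℕ → List ℕ → ℕ → Prop, (∀ n, PrimrecRel (e n)) ∧
    ∀ θ, PrimrecRel θ → ∃ n, e n = θ := by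
  classical
  have : Countable {θ : List ℕ → ℕ → Prop // PrimrecRel θ} := by
    have hP : ∀ θ : List ℕ → ℕ → Prop, PrimrecRel θ →
        Primrec fun n => if θ (ofNat (List ℕ × ℕ) n).1 (ofNat (List ℕ × ℕ) n).2 then 0 else 1 :=
      fun θ hθ => Primrec.ite
        (c := fun n => θ (ofNat (List ℕ × ℕ) n).1 (ofNat (List ℕ × ℕ) n).2)
        (hθ.comp (Primrec.fst.comp (Primrec.ofNat _)) (Primrec.snd.comp (Primrec.ofNat _)))
        (Primrec.const 0) (Primrec.const 1)
    -- Each relation is determined by its computable characteristic function on codes, and there are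
    -- countably many of these.
    refine Function.Injective.countable
      (f := fun θ : {θ : List ℕ → ℕ → Prop // PrimrecRel θ} =>
        (⟨_, (hP θ.1 θ.2).to_comp⟩ : {f : ℕ → ℕ // Computable f})) ?_
    rintro ⟨θ, hθ⟩ ⟨η, hη⟩ h
    have h' := congrFun (congrArg Subtype.val h)
    refine Subtype.ext (funext fun σ => funext fun x => propext ?_)
    have := h' (encode (σ, x))
    simp only [ofNat_encode] at this
    by_cases h1 : θ σ x <;> by_cases h2 : η σ x <;> simp_all
  have : Nonempty {θ : List ℕ → ℕ → Prop // PrimrecRel θ} :=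
    ⟨⟨fun _ _ => 0 = 0, Primrec.eq.comp (Primrec.const 0) (Primrec.const 0)⟩⟩
  obtain ⟨e, he⟩ := exists_surjective_nat {θ : List ℕ → ℕ → Prop // PrimrecRel θ}
  exact ⟨fun n => (e n).1, fun n => (e n).2, fun θ hθ =>
    (he ⟨θ, hθ⟩).imp fun n hn => congrArg Subtype.val hn⟩

/-- Dependent choice, with requirement `n` met at stage `n + 1`. It yields both the nested classes
of the basis theorem and the descending sequence of conditions. -/
theorem exists_seq_of_step {S : Type*} {r : S → S → Prop} {Q : ℕ → S → Prop}
    (h : ∀ s n, ∃ s', r s s' ∧ Q n s') (s₀ : S) :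
    ∃ u : ℕ → S, u 0 = s₀ ∧ (∀ n, r (u n) (u (n + 1))) ∧ ∀ n, Q n (u (n + 1)) := by
  choose F hF using h
  exact ⟨fun n => Nat.rec s₀ (fun n s => F s n) n, rfl, fun n => (hF _ n).1, fun n => (hF _ n).2⟩

/-! ### Effective compactness of computably bounded classes -/

/-- Primitive recursiveness of a ternary relation. -/
def PrimrecRel₃ (V : ℕ → List ℕ → List ℕ → Prop) : Prop :=
  PrimrecPred fun p : ℕ × List ℕ × List ℕ => V p.1 p.2.1 p.2.2

/-- The list of all lists that are pointwise bounded by `bs`. -/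
def boundedLists (bs : List ℕ) : List (List ℕ) :=
  bs.foldr (fun b L => (List.range (b + 1)).flatMap fun a => L.map fun l => a :: l) [[]]

theorem primrec_boundedLists : Primrec boundedLists := by
  refine Primrec.list_foldr (h := fun (_ : List ℕ) (q : ℕ × List (List ℕ)) =>
    (List.range (q.1 + 1)).flatMap fun a => q.2.map fun l => a :: l) Primrec.id
    (Primrec.const [[]]) ?_
  refine (Primrec.list_flatMap (f := fun q : List ℕ × ℕ × List (List ℕ) => List.range (q.2.1 + 1))
    (g := fun q a => q.2.2.map fun l => a :: l)
    (Primrec.list_range.comp (Primrec.succ.comp (Primrec.fst.comp Primrec.snd))) ?_).to₂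
  exact (Primrec.list_map (f := fun q : (List ℕ × ℕ × List (List ℕ)) × ℕ => q.1.2.2)
    (g := fun q l => q.2 :: l)
    (Primrec.snd.comp (Primrec.snd.comp Primrec.fst))
    (Primrec.list_cons.comp (Primrec.snd.comp Primrec.fst) Primrec.snd).to₂).to₂

theorem mem_boundedLists {l bs : List ℕ} :
    l ∈ boundedLists bs ↔ List.Forall₂ (· ≤ ·) l bs := by
  induction bs generalizing l with
  | nil => simp [boundedLists]
  | cons b bs ih =>
    have : boundedLists (b :: bs) =
      (List.range (b + 1)).flatMap fun a => (boundedLists bs).map fun l => a :: l := rfl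
    rw [this]
    simp only [List.mem_flatMap, List.mem_range, List.mem_map, ih, List.forall₂_cons_right_iff]
    constructor
    · rintro ⟨a, ha, l', hl', rfl⟩
      exact ⟨a, l', by omega, hl', rfl⟩
    · rintro ⟨a, l', ha, hl', rfl⟩
      exact ⟨a, by omega, l', hl', rfl⟩

theorem mem_boundedLists_seg {l : List ℕ} {b : ℕ → ℕ} {k : ℕ} :
    l ∈ boundedLists (seg b k) ↔ ∃ g : ℕ → ℕ, (∀ i, g i ≤ b i) ∧ l = seg g k := by
  rw [mem_boundedLists]
  constructor
  · intro h
    have hlen : l.length = k := by simpa using h.length_eq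
    -- Padding with `0` beyond the end of `l` respects any bound.
    refine ⟨fun i => l.getD i 0, fun i => ?_, ?_⟩
    · by_cases hi : i < l.length
      · have := (List.forall₂_iff_get.1 h).2 i hi (by simpa [hlen] using hi)
        simpa [List.getD_eq_getElem?_getD, hi, seg] using this
      · simp [List.getD_eq_getElem?_getD, hi]
    · refine List.ext_getElem (by simpa using hlen) fun i h1 h2 => ?_
      simp [seg, List.getD_eq_getElem?_getD, h1]
  · rintro ⟨g, hg, rfl⟩
    rw [List.forall₂_iff_get]
    simp [seg, hg]

theorem seg_eq_ofFn (g : ℕ → ℕ) (k : ℕ) : seg g k = List.ofFn fun i : Fin k => g i := by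
  refine List.ext_getElem (by simp) fun i _ _ => by simp [seg]

theorem isClopen_seg (k : ℕ) (P : List ℕ → Prop) : IsClopen {g : ℕ → ℕ | P (seg g k)} := by
  have : {g : ℕ → ℕ | P (seg g k)} =
      (fun (g : ℕ → ℕ) (i : Fin k) => g i) ⁻¹' {t | P (List.ofFn t)} := by
    ext g
    simp [seg_eq_ofFn]
  rw [this]
  exact (isClopen_discrete _).preimage (by fun_prop)

theorem isCompact_bounded (b : ℕ → ℕ) : IsCompact {g : ℕ → ℕ | ∀ i, g i ≤ b i} := by
  have := isCompact_univ_pi (s := fun i => Set.Iic (b i)) fun i => (Set.finite_Iic (b i)).isCompact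
  convert this using 1
  ext g
  simp [Pi.le_def]

/-- The sets of `g` caught at level `k` are open and cover a compact product of finite sets; `n` is
the largest index of a finite subcover. -/
theorem exists_uniform_bound {b : ℕ → ℕ} {P : ℕ → List ℕ → Prop}
    (h : ∀ g : ℕ → ℕ, (∀ i, g i ≤ b i) → ∃ k, P k (seg g k)) :
    ∃ n, ∀ g : ℕ → ℕ, (∀ i, g i ≤ b i) → ∃ k ≤ n, P k (seg g k) := by
  obtain ⟨t, ht⟩ := (isCompact_bounded b).elim_finite_subcover
    (fun k => {g : ℕ → ℕ | P k (seg g k)}) (fun k => (isClopen_seg k (P k)).isOpen)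
    (fun g hg => by simpa using h g hg)
  refine ⟨t.sup id, fun g hg => ?_⟩
  obtain ⟨k, hk, hP⟩ : ∃ k ∈ t, P k (seg g k) := by simpa using ht hg
  exact ⟨k, Finset.le_sup (f := id) hk, hP⟩

/-- Effective compactness: if an open cover of a computably bounded class is effectively given,
then the level at which it covers the class is computable. -/
theorem exists_red_bound {V : ℕ → List ℕ → List ℕ → Prop} (hV : PrimrecRel₃ V) {Z b : ℕ → ℕ}
    (hb : Red Z b)
    (h : ∀ x (g : ℕ → ℕ), (∀ i, g i ≤ b i) → ∃ k, V x (seg g k) (seg Z k)) :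
    ∃ m, Red Z m ∧ ∀ x (g : ℕ → ℕ), (∀ i, g i ≤ b i) → ∃ k ≤ m x, V x (seg g k) (seg Z k) := by
  set W := pairFun b Z with hW
  -- Being covered by level `n` is decidable from segments of `b` and `Z` of length `n`, since only
  -- finitely many strings lie below `b`. Unbounded search then finds a level.
  let θ : List ℕ → ℕ → Prop := fun σ x =>
    ∀ τ ∈ boundedLists (σ.map fun c => c.unpair.1), ∃ k < σ.length + 1,
      V x (τ.take k) ((σ.map fun c => c.unpair.2).take k)
  have hθ : PrimrecRel θ := by
    have hfst : Primrec fun σ : List ℕ => σ.map fun c => c.unpair.1 :=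
      Primrec.list_map Primrec.id ((Primrec.fst.comp (Primrec.unpair.comp Primrec.snd))).to₂
    have hsnd : Primrec fun σ : List ℕ => σ.map fun c => c.unpair.2 :=
      Primrec.list_map Primrec.id ((Primrec.snd.comp (Primrec.unpair.comp Primrec.snd))).to₂
    refine PrimrecPred.ball_mem (primrec_boundedLists.comp (hfst.comp Primrec.fst)) ?_
    refine PrimrecPred.bex_lt (Primrec.succ.comp (Primrec.list_length.comp
      (Primrec.fst.comp Primrec.fst))) ?_
    refine PrimrecPred.comp hV (f := fun q : ((List ℕ × ℕ) × List ℕ) × ℕ =>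
      (q.1.1.2, q.1.2.take q.2, (q.1.1.1.map fun c => c.unpair.2).take q.2)) ?_
    refine (Primrec.snd.comp (Primrec.fst.comp Primrec.fst)).pair (Primrec.pair ?_ ?_)
    · exact Primrec.list_take.comp Primrec.snd (Primrec.snd.comp Primrec.fst)
    · exact Primrec.list_take.comp Primrec.snd
        (hsnd.comp (Primrec.fst.comp (Primrec.fst.comp Primrec.fst)))
  have hiff : ∀ n x, θ (seg W n) x ↔ ∀ g : ℕ → ℕ, (∀ i, g i ≤ b i) →
      ∃ k ≤ n, V x (seg g k) (seg Z k) := by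
    intro n x
    simp only [θ, map_seg, hW, pairFun, Nat.unpair_pair, length_seg]
    constructor
    · intro h g hg
      obtain ⟨k, hk, hv⟩ := h (seg g n) (mem_boundedLists_seg.2 ⟨g, hg, rfl⟩)
      rw [take_seg _ (by omega), take_seg _ (by omega)] at hv
      exact ⟨k, by omega, hv⟩
    · intro h τ hτ
      obtain ⟨g, hg, rfl⟩ := mem_boundedLists_seg.1 hτ
      obtain ⟨k, hk, hv⟩ := h g hg
      refine ⟨k, by omega, ?_⟩
      rwa [take_seg _ hk, take_seg _ hk]
  obtain ⟨m, hm, hmθ⟩ := Red.search (o := W) hθ fun x => by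
    simp only [hiff]
    exact exists_uniform_bound (P := fun k s => V x s (seg Z k)) (h x)
  exact ⟨m, (hb.pair (Red.refl Z)).trans hm, fun x => (hiff _ _).1 (hmθ x)⟩

/-! ### The computably dominated basis theorem -/

/-- The string coding the pair of the strings `σ` and `τ`. -/
def zipPair (σ τ : List ℕ) : List ℕ :=
  (List.range σ.length).map fun i => Nat.pair (σ.getD i 0) (τ.getD i 0)

theorem primrec_zipPair : Primrec₂ zipPair :=
  Primrec.list_map (f := fun q : List ℕ × List ℕ => List.range q.1.length)
    (g := fun q i => Nat.pair (q.1.getD i 0) (q.2.getD i 0))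
    (Primrec.list_range.comp (Primrec.list_length.comp Primrec.fst))
    (Primrec₂.natPair.comp
      ((Primrec.list_getD 0).comp (Primrec.fst.comp Primrec.fst) Primrec.snd)
      ((Primrec.list_getD 0).comp (Primrec.snd.comp Primrec.fst) Primrec.snd)).to₂

theorem zipPair_seg (f g : ℕ → ℕ) (n : ℕ) : zipPair (seg f n) (seg g n) = seg (pairFun f g) n := by
  rw [zipPair, length_seg, seg.eq_def (pairFun f g)]
  refine List.map_congr_left fun i hi => ?_
  have hi := List.mem_range.1 hi
  rw [getD_seg hi, getD_seg hi, pairFun]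

/-- Every function recursive in `p` is dominated by a function recursive in `o`. -/
def DominatedOver (o p : ℕ → ℕ) : Prop :=
  ∀ h, Red p h → ∃ m, Red o m ∧ DominatedBy h m

/-- The members of the effectively closed class given by `b`, `Z` and the set `R` of bad strings. -/
def boundedClass (b Z : ℕ → ℕ) (R : List ℕ → List ℕ → Prop) : Set (ℕ → ℕ) :=
  {g | (∀ i, g i ≤ b i) ∧ ∀ k, ¬ R (seg g k) (seg Z k)}

theorem isCompact_boundedClass (b Z : ℕ → ℕ) (R : List ℕ → List ℕ → Prop) :
    IsCompact (boundedClass b Z R) := by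
  have : boundedClass b Z R =
      {g | ∀ i, g i ≤ b i} ∩ ⋂ k, {g | ¬ R (seg g k) (seg Z k)} := by
    ext g
    simp [boundedClass]
  rw [this]
  exact (isCompact_bounded b).inter_right
    (isClosed_iInter fun k => (isClopen_seg k fun s => ¬ R s (seg Z k)).isClosed)

/-- If at every `x` each `g ≤ b` either leaves the class or satisfies `θ`, effective compactness
bounds the search. Otherwise, at some `x`, declaring bad the strings on which `θ` holds leaves a
nonempty subclass. -/
theorem boundedClass_step {b Z : ℕ → ℕ} (hb : Red Z b) {R : List ℕ → List ℕ → Prop}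
    (hR : PrimrecRel R) (hne : (boundedClass b Z R).Nonempty) {θ : List ℕ → ℕ → Prop}
    (hθ : PrimrecRel θ) :
    ∃ R', PrimrecRel R' ∧ (boundedClass b Z R').Nonempty ∧
      boundedClass b Z R' ⊆ boundedClass b Z R ∧
      ((∃ x, ∀ g ∈ boundedClass b Z R', ∀ n, ¬ θ (seg (pairFun g Z) n) x) ∨
        ∃ m, Red Z m ∧ ∀ g ∈ boundedClass b Z R', ∀ x, ∃ n ≤ m x,
          θ (seg (pairFun g Z) n) x) := by
  let V : ℕ → List ℕ → List ℕ → Prop := fun x σ ζ => R σ ζ ∨ θ (zipPair σ ζ) x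
  have hV : PrimrecRel₃ V :=
    PrimrecPred.or (hR.comp (Primrec.fst.comp Primrec.snd) (Primrec.snd.comp Primrec.snd))
      (hθ.comp (primrec_zipPair.comp (Primrec.fst.comp Primrec.snd) (Primrec.snd.comp Primrec.snd))
        Primrec.fst)
  by_cases h : ∀ x (g : ℕ → ℕ), (∀ i, g i ≤ b i) → ∃ k, V x (seg g k) (seg Z k)
  · obtain ⟨m, hm, hmV⟩ := exists_red_bound hV hb h
    refine ⟨R, hR, hne, subset_rfl, .inr ⟨m, hm, fun g hg x => ?_⟩⟩
    obtain ⟨k, hk, hv⟩ := hmV x g hg.1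
    rcases hv with hv | hv
    · exact absurd hv (hg.2 k)
    · exact ⟨k, hk, by rwa [zipPair_seg] at hv⟩
  · push Not at h
    obtain ⟨x, g, hg, hgV⟩ := h
    refine ⟨V x, ?_, ⟨g, hg, hgV⟩, fun g' hg' => ⟨hg'.1, fun k hk => hg'.2 k (.inl hk)⟩,
      .inl ⟨x, fun g' hg' n hn => hg'.2 n (.inr ?_)⟩⟩
    · exact PrimrecPred.comp hV (f := fun q : List ℕ × List ℕ => (x, q.1, q.2))
        ((Primrec.const x).pair (Primrec.fst.pair Primrec.snd))
    · rwa [zipPair_seg]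

/-- The computably dominated basis theorem. -/
theorem exists_dominatedOver_mem {b Z : ℕ → ℕ} (hb : Red Z b) {R : List ℕ → List ℕ → Prop}
    (hR : PrimrecRel R) (hne : (boundedClass b Z R).Nonempty) :
    ∃ g ∈ boundedClass b Z R, DominatedOver Z (pairFun g Z) := by
  obtain ⟨e, he, hesurj⟩ := exists_enum_primrecRel
  let S := {R : List ℕ → List ℕ → Prop // PrimrecRel R ∧ (boundedClass b Z R).Nonempty}
  obtain ⟨u, hu0, hur, huQ⟩ := exists_seq_of_step (S := S)
    (r := fun s s' => boundedClass b Z s'.1 ⊆ boundedClass b Z s.1)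
    (Q := fun j s' => (∃ x, ∀ g ∈ boundedClass b Z s'.1, ∀ n, ¬ e j (seg (pairFun g Z) n) x) ∨
        ∃ m, Red Z m ∧ ∀ g ∈ boundedClass b Z s'.1, ∀ x, ∃ n ≤ m x,
          e j (seg (pairFun g Z) n) x)
    (fun s j => by
      obtain ⟨R', h1, h2, h3, h4⟩ := boundedClass_step hb s.2.1 s.2.2 (he j)
      exact ⟨⟨R', h1, h2⟩, h3, h4⟩) ⟨R, hR, hne⟩
  -- Cantor's intersection theorem: a single `g` lies in all the nested classes.
  obtain ⟨g, hg⟩ := IsCompact.nonempty_iInter_of_sequence_nonempty_isCompact_isClosed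
    (fun n => boundedClass b Z (u n).1) hur (fun n => (u n).2.2)
    (isCompact_boundedClass _ _ _) fun n => (isCompact_boundedClass _ _ _).isClosed
  have hg := Set.mem_iInter.1 hg
  refine ⟨g, by simpa [hu0] using hg 0, fun h hh => ?_⟩
  obtain ⟨θ, hθ, hθ1, hθ2⟩ := hh.exists_bounding_rel
  obtain ⟨j, rfl⟩ := hesurj θ hθ
  rcases huQ j with ⟨x, hx⟩ | ⟨m, hm, hmθ⟩
  · obtain ⟨n, hn⟩ := hθ1 x
    exact absurd hn (hx g (hg _) n)
  · refine ⟨m, hm, fun x => ?_⟩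
    obtain ⟨n, hn, hnθ⟩ := hmθ g (hg _) x
    exact (hθ2 x n hnθ).trans hn


/-! ### Characteristic functions, joins and thinning -/

open Classical in
/-- The characteristic function of a set. -/
noncomputable def chi (C : Set ℕ) (n : ℕ) : ℕ :=
  if n ∈ C then 1 else 0

theorem chi_eq_one {C : Set ℕ} {n : ℕ} : chi C n = 1 ↔ n ∈ C := by
  simp [chi]

theorem ite_chi (C : Set ℕ) (n : ℕ) [Decidable (n ∈ C)] : (if n ∈ C then 1 else 0) = chi C n := by
  by_cases h : n ∈ C <;> simp [chi, h]

theorem chi_of_mem {C : Set ℕ} {n : ℕ} (h : n ∈ C) : chi C n = 1 :=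
  chi_eq_one.2 h

theorem chi_of_notMem {C : Set ℕ} {n : ℕ} (h : n ∉ C) : chi C n = 0 := by
  simp [chi, h]

theorem chi_le_one (C : Set ℕ) (n : ℕ) : chi C n ≤ 1 := by
  unfold chi
  split_ifs <;> simp

theorem chi_congr {A B : Set ℕ} {m n : ℕ} (h : m ∈ A ↔ n ∈ B) : chi A m = chi B n := by
  classical
  exact if_congr h rfl rfl

theorem computableFrom_iff_red {C : Set ℕ} {f : ℕ → ℕ} : ComputableFrom C f ↔ Red (chi C) f :=
  RecursiveIn.iff_nat

theorem mem_join {A B : Set ℕ} {n : ℕ} :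
    n ∈ join A B ↔ if n % 2 = 0 then n / 2 ∈ A else n / 2 ∈ B := by
  simp only [join, Set.mem_union, Set.mem_image]
  split_ifs with h
  · constructor
    · rintro (⟨k, hk, rfl⟩ | ⟨k, hk, rfl⟩)
      · simpa using hk
      · omega
    · exact fun hk => .inl ⟨_, hk, by omega⟩
  · constructor
    · rintro (⟨k, hk, rfl⟩ | ⟨k, hk, rfl⟩)
      · omega
      · rwa [show (2 * k + 1) / 2 = k by omega]
    · exact fun hk => .inr ⟨_, hk, by omega⟩

theorem Red.left {o f g : ℕ → ℕ} (h : Red o (pairFun f g)) : Red o f :=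
  (Red.primrec_comp (Primrec.fst.comp Primrec.unpair) h).of_eq fun n => by simp [pairFun]

theorem Red.right {o f g : ℕ → ℕ} (h : Red o (pairFun f g)) : Red o g :=
  (Red.primrec_comp (Primrec.snd.comp Primrec.unpair) h).of_eq fun n => by simp [pairFun]

theorem Red.chi_join {o : ℕ → ℕ} {A B : Set ℕ} (hA : Red o (chi A)) (hB : Red o (chi B)) :
    Red o (chi (join A B)) := by
  have hp : Primrec₂ fun n q : ℕ => if n % 2 = 0 then q.unpair.1 else q.unpair.2 :=
    Primrec.ite (c := fun p : ℕ × ℕ => p.1 % 2 = 0)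
      (Primrec.eq.comp (Primrec.nat_mod.comp Primrec.fst (Primrec.const 2)) (Primrec.const 0))
      (Primrec.fst.comp (Primrec.unpair.comp Primrec.snd))
      (Primrec.snd.comp (Primrec.unpair.comp Primrec.snd))
  refine (Red.primrec_comp₂ hp (Red.id o) ((hA.pair hB).comp
    (Red.of_primrec o (Primrec.nat_div.comp Primrec.id (Primrec.const 2))))).of_eq fun n => ?_
  by_cases h : n % 2 = 0
  · simpa [h, pairFun] using chi_congr (by simp [mem_join, h])
  · simpa [h, pairFun] using chi_congr (by simp [mem_join, h])

theorem DominatedOver.trans {o p q : ℕ → ℕ} (h : DominatedOver o p) (h' : DominatedOver p q) :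
    DominatedOver o q := by
  intro k hk
  obtain ⟨m, hm, hkm⟩ := h' k hk
  obtain ⟨m', hm', hmm⟩ := h m hm
  exact ⟨m', hm', fun x => (hkm x).trans (hmm x)⟩

theorem Red.dominatedOver {o p : ℕ → ℕ} (h : Red o p) : DominatedOver o p :=
  fun k hk => ⟨k, h.trans hk, fun _ => le_rfl⟩

/-- Every infinite set contains an infinite set on which `g` is non-decreasing, computably in `g`
and the given set. -/
theorem exists_nondecreasing_subset (g : ℕ → ℕ) {X : Set ℕ} (hX : X.Infinite) :
    ∃ Y ⊆ X, Y.Infinite ∧ (∀ x ∈ Y, ∀ y ∈ Y, x < y → g x ≤ g y) ∧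
      ∀ o, Red o g → Red o (chi X) → Red o (chi Y) := by
  -- Either some fibre of `g` on `X` is infinite, and it is the answer, or the records of `g` along
  -- `X` are.
  by_cases h : ∃ y, {x | x ∈ X ∧ g x = y}.Infinite
  · obtain ⟨y, hy⟩ := h
    refine ⟨_, fun x hx => hx.1, hy, fun x hx z hz _ => (hx.2.trans hz.2.symm).le,
      fun o hg hX => ?_⟩
    have hp : Primrec₂ fun a c : ℕ => if a = y then c else 0 :=
      Primrec.ite (c := fun p : ℕ × ℕ => p.1 = y)
        (Primrec.eq.comp Primrec.fst (Primrec.const y)) Primrec.snd (Primrec.const 0)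
    refine (Red.primrec_comp₂ hp hg hX).of_eq fun n => ?_
    split_ifs with h1
    · exact chi_congr ⟨fun h => ⟨h, h1⟩, And.left⟩
    · exact (chi_of_notMem fun h => h1 h.2).symm
  · simp only [not_exists, Set.not_infinite] at h
    -- The first element of `X` whose value exceeds `B` is a record; it exists because all fibres
    -- are finite.
    have hrec : ∀ B, ∃ n ∈ X, (∀ m < n, m ∈ X → g m ≤ g n) ∧ B < g n := by
      intro B
      have hex : ∃ n, n ∈ X ∧ B < g n := by
        by_contra hcon
        push Not at hcon
        refine hX (((Set.finite_Iic B).biUnion fun y _ => h y).subset fun x hx => ?_)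
        simp only [Set.mem_iUnion]
        exact ⟨g x, hcon x hx, hx, rfl⟩
      classical
      obtain ⟨h1, h2⟩ := Nat.find_spec hex
      refine ⟨_, h1, fun m hm hmX => ?_, h2⟩
      have := Nat.find_min hex hm
      simp only [not_and, not_lt] at this
      exact (this hmX).trans h2.le
    refine ⟨{n | n ∈ X ∧ ∀ m < n, m ∈ X → g m ≤ g n}, fun x hx => hx.1, fun hfin => ?_,
      fun x hx y hy hxy => hy.2 x hxy hx.1, fun o hg hX => ?_⟩
    · obtain ⟨B, hB⟩ := (hfin.image g).bddAbove
      obtain ⟨n, h1, h2, h3⟩ := hrec B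
      exact absurd (hB ⟨n, ⟨h1, h2⟩, rfl⟩) (by omega)
    · classical
      have hat : Primrec₂ fun (σ : List ℕ) (i : ℕ) => (σ.getD i 0).unpair :=
        Primrec.unpair.comp (Primrec.list_getD 0)
      have hF : Primrec₂ fun (σ : List ℕ) (n : ℕ) =>
          if (σ.getD n 0).unpair.1 = 1 ∧ ∀ m < n, ¬ (σ.getD m 0).unpair.1 = 1 ∨
            (σ.getD m 0).unpair.2 ≤ (σ.getD n 0).unpair.2 then 1 else 0 := by
        refine Primrec.ite (c := fun p : List ℕ × ℕ => (p.1.getD p.2 0).unpair.1 = 1 ∧ ∀ m < p.2,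
          ¬ (p.1.getD m 0).unpair.1 = 1 ∨ (p.1.getD m 0).unpair.2 ≤ (p.1.getD p.2 0).unpair.2)
          (PrimrecPred.and ?_ (PrimrecPred.ball_lt Primrec.snd (PrimrecPred.or ?_ ?_)))
          (Primrec.const 1) (Primrec.const 0)
        · exact Primrec.eq.comp (Primrec.fst.comp hat) (Primrec.const 1)
        · exact (Primrec.eq.comp (Primrec.fst.comp (hat.comp (Primrec.fst.comp Primrec.fst)
            Primrec.snd)) (Primrec.const 1)).not
        · exact Primrec.nat_le.comp (Primrec.snd.comp (hat.comp (Primrec.fst.comp Primrec.fst)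
            Primrec.snd)) (Primrec.snd.comp
            (hat.comp (Primrec.fst.comp Primrec.fst) (Primrec.snd.comp Primrec.fst)))
      refine (hX.pair hg).trans ((Red.of_seg hF (Red.of_primrec _ Primrec.succ)).of_eq fun n => ?_)
      have hval : ∀ m ≤ n, (seg (pairFun (chi X) g) n.succ).getD m 0 = Nat.pair (chi X m) (g m) :=
        fun m hm => getD_seg (by omega) 0
      refine (if_congr ?_ rfl rfl).trans (ite_chi _ _)
      rw [hval n le_rfl]
      simp only [Nat.unpair_pair, chi_eq_one, Set.mem_ofPred_eq]
      refine and_congr Iff.rfl (forall_congr' fun m => forall_congr' fun hm => ?_)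
      rw [hval m hm.le]
      simp only [Nat.unpair_pair, chi_eq_one]
      tauto

/-! ### Forcing conditions -/

/-- A forcing condition for building a non-decreasing subsequence of `f`: a stem `X ∩ [0, N)`
and a reservoir `X ∩ [N, ∞)`, given by an oracle `Z` that is computably dominated over `C`. -/
structure Condition (C : Set ℕ) (f : ℕ → ℕ) where
  /-- The length of the stem. -/
  N : ℕ
  /-- The union of the stem and the reservoir. -/
  X : Set ℕ
  /-- The oracle. -/
  Z : ℕ → ℕ
  infinite : X.Infinite
  red_X : Red Z (chi X)
  red_C : Red Z (chi C)
  dominated : DominatedOver (chi C) Z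
  mono : ∀ x ∈ X, x < N → ∀ y ∈ X, x < y → f x ≤ f y

namespace Condition

variable {C : Set ℕ} {f : ℕ → ℕ}

/-- The condition `q` extends the condition `p`. -/
def Extends (q p : Condition C f) : Prop :=
  p.N ≤ q.N ∧ q.X ⊆ p.X ∧ ∀ n < p.N, n ∈ p.X → n ∈ q.X

/-- The set `G` satisfies the condition `p`. -/
def Sat (G : Set ℕ) (p : Condition C f) : Prop :=
  G ⊆ p.X ∧ ∀ n < p.N, n ∈ p.X → n ∈ G

theorem Extends.refl (p : Condition C f) : p.Extends p :=
  ⟨le_rfl, subset_rfl, fun _ _ h => h⟩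

theorem Extends.trans {p q r : Condition C f} (h : r.Extends q) (h' : q.Extends p) :
    r.Extends p :=
  ⟨h'.1.trans h.1, h.2.1.trans h'.2.1, fun n hn hX => h.2.2 n (hn.trans_le h'.1) (h'.2.2 n hn hX)⟩

theorem Sat.of_extends {G : Set ℕ} {p q : Condition C f} (hG : Sat G q) (h : q.Extends p) :
    Sat G p :=
  ⟨hG.1.trans h.2.1, fun n hn hX => hG.2 n (hn.trans_le h.1) (h.2.2 n hn hX)⟩

/-- Only finitely many `y` have value below the maximum of `f` on `[0, k)`. This is where eventual
increase enters the forcing. -/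
theorem exists_le_of_ge (hf : EventuallyIncreasing f) (k : ℕ) :
    ∃ M, k ≤ M ∧ ∀ x < k, ∀ y, M ≤ y → f x ≤ f y := by
  set B := (Finset.range k).sup f
  have hfin : {y | f y < B}.Finite :=
    ((Set.finite_Iio B).biUnion fun v _ => hf v).subset fun x hx => by
      simp only [Set.mem_iUnion]
      exact ⟨f x, hx, rfl⟩
  obtain ⟨M, hM⟩ := hfin.bddAbove
  refine ⟨max k (M + 1), le_max_left _ _, fun x hx y hy => ?_⟩
  by_contra hlt
  have h1 : f x ≤ B := Finset.le_sup (f := f) (Finset.mem_range.2 hx)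
  have h2 : y ≤ M := hM (show f y < B by omega)
  omega

/-- A stem can be extended by any finite part of the reservoir on which `f` is non-decreasing. -/
theorem exists_extends (hf : EventuallyIncreasing f) (p : Condition C f) {k : ℕ} (hk : p.N ≤ k)
    {E : Set ℕ} (hEX : E ⊆ p.X) (hEN : ∀ n < p.N, n ∈ p.X → n ∈ E)
    (hE : ∀ x ∈ E, ∀ y ∈ E, p.N ≤ x → x < y → y < k → f x ≤ f y) :
    ∃ q : Condition C f, q.Extends p ∧ q.N = k ∧ ∀ n < k, n ∈ q.X ↔ n ∈ E := by
  obtain ⟨M, hkM, hM⟩ := exists_le_of_ge hf k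
  -- Dropping the reservoir between `k` and `M` keeps every remaining value above those of the new
  -- stem.
  let X' : Set ℕ := {n | (n < k ∧ n ∈ E) ∨ (M ≤ n ∧ n ∈ p.X)}
  refine ⟨⟨k, X', p.Z, ?_, ?_, p.red_C, p.dominated, ?_⟩, ⟨hk, ?_, ?_⟩, rfl, ?_⟩
  · refine (p.infinite.sdiff (Set.finite_Iio M)).mono fun n hn => .inr ⟨?_, hn.1⟩
    simpa using hn.2
  -- `E` enters only through the constant list of its values below `k`, so it need not be computable
  -- and the oracle does not change.
  · have hp : Primrec₂ fun n c : ℕ =>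
        if n < k then (seg (chi E) k).getD n 0 else if M ≤ n then c else 0 :=
      Primrec.ite (c := fun q : ℕ × ℕ => q.1 < k) (Primrec.nat_lt.comp Primrec.fst (.const k))
        ((Primrec.list_getD 0).comp (.const _) Primrec.fst)
        (Primrec.ite (c := fun q : ℕ × ℕ => M ≤ q.1) (Primrec.nat_le.comp (.const M) Primrec.fst)
          Primrec.snd (.const 0))
    refine (Red.primrec_comp₂ hp (Red.id _) p.red_X).of_eq fun n => ?_
    simp only [id_eq]
    split_ifs with h1 h2
    · rw [getD_seg h1]
      exact chi_congr ⟨fun h => .inl ⟨h1, h⟩, fun h => h.elim And.right fun h => by omega⟩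
    · exact chi_congr ⟨fun h => .inr ⟨h2, h⟩, fun h => h.elim (fun h => by omega) And.right⟩
    · exact (chi_of_notMem fun h => h.elim (fun h => h1 h.1) fun h => h2 h.1).symm
  · rintro x (⟨-, hx⟩ | ⟨hx, -⟩) hxk y (⟨hy, hyE⟩ | ⟨hy, -⟩) hxy
    · by_cases hxN : x < p.N
      · exact p.mono x (hEX hx) hxN y (hEX hyE) hxy
      · exact hE x hx y hyE (by omega) hxy hy
    · exact hM x hxk y hy
    · exact absurd hxk (not_lt.2 (hkM.trans hx))
    · exact hM x hxk y hy
  · rintro n (⟨-, h⟩ | ⟨-, h⟩)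
    · exact hEX h
    · exact h
  · exact fun n hn h => .inl ⟨hn.trans_le hk, hEN n hn h⟩
  · exact fun n hn => ⟨fun h => h.elim And.right fun h => by omega, fun h => .inl ⟨hn, h⟩⟩

theorem exists_extends_mem (hf : EventuallyIncreasing f) (p : Condition C f) (n : ℕ) :
    ∃ q : Condition C f, q.Extends p ∧ ∃ x ∈ q.X, n ≤ x ∧ x < q.N := by
  obtain ⟨x, hx, hnx⟩ := p.infinite.exists_gt (max n p.N)
  obtain ⟨q, h1, h2, h3⟩ := p.exists_extends hf (k := x + 1)
    (E := {m | m ∈ p.X ∧ (m < p.N ∨ m = x)}) (by omega) (fun m hm => hm.1)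
    (fun m hm hX => ⟨hX, .inl hm⟩) (fun a ha b hb h1 h2 h3 => by
      have := ha.2
      omega)
  exact ⟨q, h1, x, (h3 x (by omega)).2 ⟨hx, .inr rfl⟩, by omega, by omega⟩

/-- Some finite extension of the stem of length `N` inside the reservoir, non-decreasing for the
string `σ`, makes `θ` hold at `x`. The string `ζ` is a segment of the oracle
`pairFun b (pairFun (chi X) (chi C))`. -/
def StemForces (N : ℕ) (θ : List ℕ → ℕ → Prop) (x : ℕ) (σ ζ : List ℕ) : Prop :=
  ∃ E ∈ boundedLists (ζ.map fun c => c.unpair.2.unpair.1),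
    (∀ i < N, ¬ (ζ.map fun c => c.unpair.2.unpair.1).getD i 0 = 1 ∨ E.getD i 0 = 1) ∧
    (∀ i < ζ.length, ∀ j < ζ.length,
      i < N ∨ j ≤ i ∨ ¬ E.getD i 0 = 1 ∨ ¬ E.getD j 0 = 1 ∨ σ.getD i 0 ≤ σ.getD j 0) ∧
    θ (zipPair E (ζ.map fun c => c.unpair.2.unpair.2)) x

theorem primrecRel_stemForces (N : ℕ) {θ : List ℕ → ℕ → Prop} (hθ : PrimrecRel θ) :
    PrimrecRel₃ (StemForces N θ) := by
  have hX : Primrec fun ζ : List ℕ => ζ.map fun c => c.unpair.2.unpair.1 :=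
    Primrec.list_map Primrec.id (Primrec.fst.comp (Primrec.unpair.comp
      (Primrec.snd.comp (Primrec.unpair.comp Primrec.snd)))).to₂
  have hC : Primrec fun ζ : List ℕ => ζ.map fun c => c.unpair.2.unpair.2 :=
    Primrec.list_map Primrec.id (Primrec.snd.comp (Primrec.unpair.comp
      (Primrec.snd.comp (Primrec.unpair.comp Primrec.snd)))).to₂
  have hget := Primrec.list_getD (0 : ℕ)
  have hζ : Primrec fun p : ℕ × List ℕ × List ℕ => p.2.2 := Primrec.snd.comp Primrec.snd
  have hE : Primrec fun p : (ℕ × List ℕ × List ℕ) × List ℕ => p.2 := Primrec.snd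
  refine PrimrecPred.bex_mem (primrec_boundedLists.comp (hX.comp hζ)) ?_
  refine PrimrecPred.and ?_ (PrimrecPred.and ?_ ?_)
  · refine PrimrecPred.ball_lt (Primrec.const N) (PrimrecPred.or (PrimrecPred.not ?_) ?_)
    · exact Primrec.eq.comp (hget.comp (hX.comp (hζ.comp (Primrec.fst.comp Primrec.fst)))
        Primrec.snd) (Primrec.const 1)
    · exact Primrec.eq.comp (hget.comp (hE.comp Primrec.fst) Primrec.snd) (Primrec.const 1)
  · refine PrimrecPred.ball_lt (Primrec.list_length.comp (hζ.comp Primrec.fst)) ?_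
    refine PrimrecPred.ball_lt
      (Primrec.list_length.comp (hζ.comp (Primrec.fst.comp Primrec.fst))) ?_
    have hi : Primrec fun p : (((ℕ × List ℕ × List ℕ) × List ℕ) × ℕ) × ℕ => p.1.2 :=
      Primrec.snd.comp Primrec.fst
    have hj : Primrec fun p : (((ℕ × List ℕ × List ℕ) × List ℕ) × ℕ) × ℕ => p.2 := Primrec.snd
    have hE' := hE.comp ((Primrec.fst (α := ((ℕ × List ℕ × List ℕ) × List ℕ)) (β := ℕ)).comp
      (Primrec.fst (β := ℕ)))
    have hσ : Primrec fun p : (((ℕ × List ℕ × List ℕ) × List ℕ) × ℕ) × ℕ => p.1.1.1.2.1 :=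
      Primrec.fst.comp (Primrec.snd.comp (Primrec.fst.comp (Primrec.fst.comp Primrec.fst)))
    refine PrimrecPred.or ?_ (PrimrecPred.or ?_ (PrimrecPred.or (PrimrecPred.not ?_)
      (PrimrecPred.or (PrimrecPred.not ?_) ?_)))
    · exact Primrec.nat_lt.comp hi (Primrec.const N)
    · exact Primrec.nat_le.comp hj hi
    · exact Primrec.eq.comp (hget.comp hE' hi) (Primrec.const 1)
    · exact Primrec.eq.comp (hget.comp hE' hj) (Primrec.const 1)
    · exact Primrec.nat_le.comp (hget.comp hσ hi) (hget.comp hσ hj)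
  · exact hθ.comp (primrec_zipPair.comp hE (hC.comp (hζ.comp Primrec.fst)))
      (Primrec.fst.comp Primrec.fst)

/-- The set-theoretic meaning of `StemForces`. Pairs starting in the stem are exempt from
monotonicity: `g` is arbitrary there, and `Condition.mono` already handles `f`. -/
theorem stemForces_seg {N : ℕ} {θ : List ℕ → ℕ → Prop} {x k : ℕ} {g b : ℕ → ℕ} {X : Set ℕ} :
    StemForces N θ x (seg g k) (seg (pairFun b (pairFun (chi X) (chi C))) k) ↔
      ∃ E ⊆ X, (∀ n < N, n < k → n ∈ X → n ∈ E) ∧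
        (∀ i ∈ E, ∀ j ∈ E, N ≤ i → i < j → j < k → g i ≤ g j) ∧
        θ (seg (pairFun (chi E) (chi C)) k) x := by
  unfold StemForces
  simp only [map_seg, pairFun, Nat.unpair_pair, length_seg]
  change (∃ E ∈ boundedLists (seg (chi X) k),
    (∀ i < N, ¬ (seg (chi X) k).getD i 0 = 1 ∨ E.getD i 0 = 1) ∧ _ ∧
      θ (zipPair E (seg (chi C) k)) x) ↔ _
  constructor
  · rintro ⟨l, hl, h1, h2, h3⟩
    obtain ⟨c, hc, rfl⟩ := mem_boundedLists_seg.1 hl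
    -- As `c ≤ chi X ≤ 1`, the function `c` is a characteristic function.
    have hcE : chi {n | c n = 1} = c := by
      funext n
      have := (hc n).trans (chi_le_one X n)
      by_cases h : c n = 1
      · rw [chi_of_mem (by exact h), h]
      · rw [chi_of_notMem (by exact h)]
        omega
    refine ⟨{n | c n = 1}, fun n hn => ?_, fun n hn hnk hX => ?_, fun i hi j hj hN hij hk => ?_, ?_⟩
    · have h1 := hc n
      have h2 : c n = 1 := hn
      by_contra hX
      rw [chi_of_notMem hX] at h1
      omega
    · have := h1 n hn
      rw [getD_seg hnk, getD_seg hnk, chi_eq_one] at this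
      tauto
    · have := h2 i (by omega) j hk
      rw [getD_seg hk, getD_seg hk, getD_seg (hij.trans hk), getD_seg (hij.trans hk)] at this
      have hi' : c i = 1 := hi
      have hj' : c j = 1 := hj
      omega
    · rw [hcE]
      rwa [zipPair_seg] at h3
  · rintro ⟨E, hEX, h1, h2, h3⟩
    refine ⟨seg (chi E) k, mem_boundedLists_seg.2 ⟨chi E, fun i => ?_, rfl⟩, fun i hi => ?_,
      fun i hi j hj => ?_, ?_⟩
    · by_cases h : i ∈ E
      · rw [chi_of_mem h, chi_of_mem (hEX h)]
      · rw [chi_of_notMem h]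
        exact Nat.zero_le _
    · by_cases hik : i < k
      · rw [getD_seg hik, getD_seg hik, chi_eq_one, chi_eq_one]
        have := h1 i hi hik
        tauto
      · left
        simp [List.getD_eq_getElem?_getD, hik]
    · rw [getD_seg hi, getD_seg hj, getD_seg hi, getD_seg hj, chi_eq_one, chi_eq_one]
      by_cases hiE : i ∈ E <;> by_cases hjE : j ∈ E <;> simp only [hiE, hjE, not_true_eq_false,
        not_false_eq_true, true_or, or_true, false_or]
      have := fun hN hij => h2 i hiE j hjE hN hij hj
      by_contra hcon
      push Not at hcon
      have := this hcon.1 hcon.2.1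
      omega
    · rwa [zipPair_seg]

/-- Every condition has an extension that forces the computation `θ` to diverge somewhere, or to
converge with a value below the hyperimmune function `a`. -/
theorem exists_extends_forcing (hf : EventuallyIncreasing f) {b : ℕ → ℕ} (hb : Red (chi C) b)
    (hfb : DominatedBy f b) {θ : List ℕ → ℕ → Prop} (hθ : PrimrecRel θ) {a : ℕ → ℕ}
    (ha : HyperimmuneFun C a) (p : Condition C f) :
    ∃ q : Condition C f, q.Extends p ∧
      ((∃ x, ∀ G, Sat G q → ∀ n, ¬ θ (seg (pairFun (chi G) (chi C)) n) x) ∨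
        ∃ x n, n < a x ∧ ∀ G, Sat G q → θ (seg (pairFun (chi G) (chi C)) n) x) := by
  set W := pairFun b (pairFun (chi p.X) (chi C)) with hW
  have hZW : Red p.Z W := (p.red_C.trans hb).pair (p.red_X.pair p.red_C)
  have hWb : Red W b := (Red.refl W).left
  have hWX : Red W (chi p.X) := (Red.refl W).right.left
  have hWC : Red W (chi C) := (Red.refl W).right.right
  have hV := primrecRel_stemForces p.N hθ
  by_cases h : ∀ x (g : ℕ → ℕ), (∀ i, g i ≤ b i) → ∃ k, StemForces p.N θ x (seg g k) (seg W k)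
  · obtain ⟨m, hm, hmV⟩ := exists_red_bound hV hWb h
    -- Hyperimmunity is available over `C` only, so the `Z`-computable bound is first replaced by a
    -- `C`-computable one.
    obtain ⟨m', hm', hmm⟩ := p.dominated m (hZW.trans hm)
    obtain ⟨x, hx⟩ : ∃ x, m' x < a x := by
      have := ha m' (computableFrom_iff_red.2 hm')
      simpa [DominatedBy] using this
    obtain ⟨k, hk, hkV⟩ := hmV x f hfb
    obtain ⟨E, hEX, hEN, hE, hθE⟩ := stemForces_seg.1 hkV
    have hka : k < a x := (hk.trans (hmm x)).trans_lt hx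
    -- If the use lies within the stem, `p` itself already forces convergence.
    by_cases hkN : k ≤ p.N
    · refine ⟨p, Extends.refl p, .inr ⟨x, k, hka, fun G hG => ?_⟩⟩
      rwa [seg_congr (o' := pairFun (chi E) (chi C))]
      intro i hi
      rw [pairFun, pairFun, chi_congr (A := G) (B := E)]
      exact ⟨fun h => hEN i (hi.trans_le hkN) hi (hG.1 h), fun h => hG.2 i (hi.trans_le hkN) (hEX h)⟩
    · obtain ⟨q, h1, h2, h3⟩ := p.exists_extends hf (k := k) (by omega) hEX
        (fun n hn hX => hEN n hn (by omega) hX) hE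
      refine ⟨q, h1, .inr ⟨x, k, hka, fun G hG => ?_⟩⟩
      rwa [seg_congr (o' := pairFun (chi E) (chi C))]
      intro i hi
      rw [pairFun, pairFun, chi_congr (A := G) (B := E)]
      exact ⟨fun h => (h3 i hi).1 (hG.1 h), fun h => hG.2 i (by omega) ((h3 i hi).2 h)⟩
  · push Not at h
    obtain ⟨x, g₀, hg₀, hgV₀⟩ := h
    have hR : PrimrecRel (StemForces p.N θ x) :=
      PrimrecPred.comp hV (f := fun q : List ℕ × List ℕ => (x, q.1, q.2))
        ((Primrec.const x).pair (Primrec.fst.pair Primrec.snd))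
    -- An arbitrary counterexample could compute too much; this one may join the oracle of the
    -- condition.
    obtain ⟨g, ⟨-, hgV⟩, hdom⟩ := exists_dominatedOver_mem hWb hR ⟨g₀, hg₀, hgV₀⟩
    have hWg : Red (pairFun g W) g := (Red.refl _).left
    have hWW : Red (pairFun g W) W := (Red.refl _).right
    obtain ⟨Y, hYX, hYinf, hYmono, hYred⟩ := exists_nondecreasing_subset g p.infinite
    let X' : Set ℕ := {n | n ∈ p.X ∧ (n < p.N ∨ n ∈ Y)}
    have hX' : Red (pairFun g W) (chi X') := by
      have hp : Primrec₂ fun n c : ℕ => if n < p.N then c.unpair.1 else c.unpair.2 :=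
        Primrec.ite (c := fun q : ℕ × ℕ => q.1 < p.N)
          (Primrec.nat_lt.comp Primrec.fst (.const p.N))
          (Primrec.fst.comp (Primrec.unpair.comp Primrec.snd))
          (Primrec.snd.comp (Primrec.unpair.comp Primrec.snd))
      refine (Red.primrec_comp₂ hp (Red.id _) ((hWW.trans hWX).pair
        (hYred _ hWg (hWW.trans hWX)))).of_eq fun n => ?_
      simp only [id_eq, pairFun, Nat.unpair_pair]
      split_ifs with h1
      · exact chi_congr ⟨fun h => ⟨h, .inl h1⟩, And.left⟩
      · exact chi_congr ⟨fun h => ⟨hYX h, .inr h⟩, fun h => h.2.resolve_left h1⟩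
    refine ⟨⟨p.N, X', pairFun g W, hYinf.mono fun n hn => ⟨hYX hn, .inr hn⟩, hX', hWW.trans hWC,
      p.dominated.trans (hZW.dominatedOver.trans hdom),
      fun x hx hxN y hy hxy => p.mono x hx.1 hxN y hy.1 hxy⟩,
      ⟨le_rfl, fun n hn => hn.1, fun n hn hX => ⟨hX, .inl hn⟩⟩, .inl ⟨x, fun G hG n hn => ?_⟩⟩
    -- If `θ` held along `G`, then `G` would itself be an extension of the stem non-decreasing for
    -- `g`, against the choice of `g`.
    refine hgV n (stemForces_seg.2 ⟨G, fun i hi => (hG.1 hi).1,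
      fun i hi _ hX => hG.2 i hi ⟨hX, .inl hi⟩, fun i hi j hj hN hij _ => ?_, hn⟩)
    exact hYmono i ((hG.1 hi).2.resolve_left (by omega)) j
      ((hG.1 hj).2.resolve_left (by omega)) hij

end Condition

/-! ### The generic set -/

open Condition in
/-- Computably bounded, eventually increasing functions have infinite non-decreasing subsequences
preserving hyperimmunity. -/
theorem exists_isInfNonDecreasing {C : Set ℕ} {A : ℕ → Set ℕ} (hA : ∀ i, Hyperimmune C (A i))
    {f : ℕ → ℕ} (hfb : ComputablyBounded C f) (hf : EventuallyIncreasing f) :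
    ∃ G : Set ℕ, IsInfNonDecreasing f G ∧ ∀ i, Hyperimmune (join G C) (A i) := by
  obtain ⟨b, hb, hfb⟩ := hfb
  rw [computableFrom_iff_red] at hb
  obtain ⟨e, he, hesurj⟩ := exists_enum_primrecRel
  let p₀ : Condition C f := ⟨0, Set.univ, chi C, Set.infinite_univ,
    (Red.of_primrec _ (Primrec.const 1)).of_eq fun n => by simp [chi], Red.refl _,
    (Red.refl _).dominatedOver, fun _ _ h => absurd h (Nat.not_lt_zero _)⟩
  obtain ⟨u, -, hur, huQ⟩ := exists_seq_of_step (S := Condition C f)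
    (r := fun p q => q.Extends p)
    -- Stage `n` treats the pair of a computation and a hyperimmune set coded by `n`, and puts an
    -- element at least `n` into the stem, so that `G` is infinite.
    (Q := fun n q => ((∃ x, ∀ G, Sat G q → ∀ k,
          ¬ e n.unpair.1 (seg (pairFun (chi G) (chi C)) k) x) ∨
        ∃ x k, k < principalFun (A n.unpair.2) x ∧ ∀ G, Sat G q →
          e n.unpair.1 (seg (pairFun (chi G) (chi C)) k) x) ∧
      ∃ x ∈ q.X, n ≤ x ∧ x < q.N)
    (fun p n => by
      obtain ⟨q, hqp, hq⟩ :=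
        p.exists_extends_forcing hf hb hfb (he n.unpair.1) (hA n.unpair.2).2
      obtain ⟨r, hrq, hr⟩ := q.exists_extends_mem hf n
      refine ⟨r, hrq.trans hqp, hq.imp ?_ ?_, hr⟩
      · exact fun ⟨x, hx⟩ => ⟨x, fun G hG => hx G (hG.of_extends hrq)⟩
      · exact fun ⟨x, k, hk, hx⟩ => ⟨x, k, hk, fun G hG => hx G (hG.of_extends hrq)⟩) p₀
  have hle : ∀ {m n}, m ≤ n → (u n).Extends (u m) := by
    intro m n h
    induction h with
    | refl => exact Extends.refl _
    | step _ ih => exact (hur _).trans ih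
  -- The union of the stems.
  let G : Set ℕ := {n | ∃ k, n ∈ (u k).X ∧ n < (u k).N}
  have hG : ∀ k, Sat G (u k) := by
    refine fun k => ⟨?_, fun n hn hX => ⟨k, hX, hn⟩⟩
    rintro n ⟨j, hj, hjN⟩
    rcases le_total j k with h | h
    · exact (hle h).2.2 n hjN hj
    · exact (hle h).2.1 hj
  refine ⟨G, ⟨?_, ?_⟩, fun i => ⟨(hA i).1, fun h hh hdom => ?_⟩⟩
  · refine Set.infinite_of_not_bddAbove fun ⟨B, hB⟩ => ?_
    obtain ⟨x, hx, hle, hlt⟩ := (huQ (B + 1)).2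
    have : x ≤ B := hB ⟨_, hx, hlt⟩
    omega
  · rintro x ⟨k, hx, hxN⟩ y hy hxy
    exact (u k).mono x hx hxN y ((hG k).1 hy) hxy
  · have hred : Red (pairFun (chi G) (chi C)) h :=
      (Red.chi_join (Red.refl _).left (Red.refl _).right).trans (computableFrom_iff_red.1 hh)
    -- Forced divergence would contradict totality of `h`; forced convergence gives `h x ≤ k`,
    -- strictly below the principal function at `x`.
    obtain ⟨θ, hθ, hθ1, hθ2⟩ := hred.exists_bounding_rel
    obtain ⟨j, rfl⟩ := hesurj θ hθ
    have := (huQ (Nat.pair j i)).1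
    simp only [Nat.unpair_pair] at this
    rcases this with ⟨x, hx⟩ | ⟨x, k, hk, hx⟩
    · obtain ⟨n, hn⟩ := hθ1 x
      exact hx G (hG _) n hn
    · have h1 := hθ2 x k (hx G (hG _))
      have h2 := hdom x
      omega

/-! ### The problems `ICNS` and `LNS` -/

theorem Hyperimmune.join_of_red {C G A : Set ℕ} (hA : Hyperimmune C A) (hG : Red (chi C) (chi G)) :
    Hyperimmune (join G C) A :=
  ⟨hA.1, fun h hh => hA.2 h (computableFrom_iff_red.2
    ((Red.chi_join hG (Red.refl _)).trans (computableFrom_iff_red.1 hh)))⟩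

theorem IsLimitFun.unique {g : ℕ → ℕ → ℕ} {f f' : ℕ → ℕ} (h : IsLimitFun g f)
    (h' : IsLimitFun g f') : f = f' := by
  funext x
  obtain ⟨s, h1, h2⟩ := ((h x).and (h' x)).exists
  exact h1.symm.trans h2

/-- Only the bound, the right half of the instance, has to be computable; the approximation serves
just to determine `f`. -/
theorem preservesHyperimmunity_ICNS : ICNS.PreservesHyperimmunity := by
  rintro C A hA X ⟨⟨f, hf, hfb⟩, f', hf', hinc⟩ hX
  obtain rfl := hf.unique hf'
  rw [computableFrom_iff_red] at hX
  have hright : ComputableFrom C (right X) := computableFrom_iff_red.2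
    (hX.comp (Red.of_primrec _ Primrec.nat_double_succ))
  obtain ⟨G, hG, hGA⟩ := exists_isInfNonDecreasing hA ⟨_, hright, hfb⟩ hinc
  exact ⟨G, ⟨f, hf, hG⟩, hGA⟩

/-- If infinitely many `x` satisfy `X ⟨x, s⟩ ≤ y` for some `s`, then some infinite set
of such `x` is computable in `X`. -/
theorem exists_red_infinite_subset {X : ℕ → ℕ} {y : ℕ}
    (h : {x | ∃ s, X (Nat.pair x s) ≤ y}.Infinite) (N : ℕ) :
    ∃ G : Set ℕ, G.Infinite ∧ Red X (chi G) ∧ ∀ x ∈ G, N ≤ x ∧ ∃ s, X (Nat.pair x s) ≤ y := by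
  classical
  -- `t n` codes a pair `(x, s)` witnessing `X ⟨x, s⟩ ≤ y` with `x` at least both `n` and `N`.
  have hTest : ∃ t, Red X t ∧ ∀ n, N ≤ (t n).unpair.1 ∧ n ≤ (t n).unpair.1 ∧ X (t n) ≤ y := by
    have hp : Primrec₂ fun p v : ℕ =>
        if N ≤ p.unpair.2.unpair.1 ∧ p.unpair.1 ≤ p.unpair.2.unpair.1 ∧ v ≤ y then 0 else 1 := by
      have h1 : Primrec fun q : ℕ × ℕ => q.1.unpair.2.unpair.1 :=
        Primrec.fst.comp (Primrec.unpair.comp (Primrec.snd.comp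
          (Primrec.unpair.comp Primrec.fst)))
      exact Primrec.ite (c := fun q : ℕ × ℕ => N ≤ q.1.unpair.2.unpair.1 ∧
          q.1.unpair.1 ≤ q.1.unpair.2.unpair.1 ∧ q.2 ≤ y)
        (PrimrecPred.and (Primrec.nat_le.comp (.const N) h1) (PrimrecPred.and
          (Primrec.nat_le.comp (Primrec.fst.comp (Primrec.unpair.comp Primrec.fst)) h1)
          (Primrec.nat_le.comp Primrec.snd (.const y)))) (.const 0) (.const 1)
    obtain ⟨t, ht, ht0⟩ := Red.rfind (Red.primrec_comp₂ hp (Red.id X) ((Red.refl X).comp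
      (Red.of_primrec X (Primrec.snd.comp Primrec.unpair)))) fun n => by
        obtain ⟨x, ⟨s, hs⟩, hx⟩ := h.exists_gt (max n N)
        refine ⟨Nat.pair x s, ?_⟩
        have : N ≤ x ∧ n ≤ x := by omega
        simp [hs, this]
    exact ⟨t, ht, fun n => by simpa using ht0 n⟩
  obtain ⟨t, ht, htn⟩ := hTest
  let q : ℕ → ℕ := fun n => (t n).unpair.1
  have hq : Red X q := Red.primrec_comp (Primrec.fst.comp Primrec.unpair) ht
  refine ⟨Set.range q, ?_, hq.trans ?_, ?_⟩
  · refine Set.infinite_of_not_bddAbove fun ⟨B, hB⟩ => ?_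
    have h1 : q (B + 1) ≤ B := hB ⟨_, rfl⟩
    have h2 : B + 1 ≤ q (B + 1) := (htn (B + 1)).2.1
    omega
  · have hF : Primrec₂ fun (σ : List ℕ) (v : ℕ) => if v ∈ σ then 1 else 0 := by
      refine Primrec.ite (c := fun p : List ℕ × ℕ => p.2 ∈ p.1) ?_ (.const 1) (.const 0)
      refine (PrimrecPred.bex_mem (f := fun p : List ℕ × ℕ => p.1) (p := fun p x => x = p.2)
        Primrec.fst (Primrec.eq.comp Primrec.snd (Primrec.snd.comp Primrec.fst))).of_eq ?_
      simp
    -- Since `n ≤ q n`, a number `v` is in the range exactly when it is among `q 0, …, q v`, even if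
    -- `q` is not monotone.
    refine (Red.of_seg hF (Red.of_primrec _ Primrec.succ)).of_eq fun v => ?_
    refine (if_congr ?_ rfl rfl).trans (ite_chi _ _)
    simp only [seg, List.mem_map, List.mem_range, Set.mem_range]
    constructor
    · exact fun ⟨n, _, hn⟩ => ⟨n, hn⟩
    · rintro ⟨n, rfl⟩
      exact ⟨n, Nat.lt_succ_of_le (htn n).2.1, rfl⟩
  · rintro _ ⟨n, rfl⟩
    exact ⟨(htn n).1, (t n).unpair.2, by simpa [q] using (htn n).2.2⟩

/-- The limit is the minimum of each row, so `f x ≤ y` is a `Σ₁` condition. If `y` is the least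
value with infinite fibre, then `f x < y` for only finitely many `x`, and past these a computable
infinite set of `x` with `f x ≤ y` has constant value `y`. -/
theorem preservesHyperimmunity_LNS : LNS.PreservesHyperimmunity := by
  classical
  intro C A hA X hX hXC
  have hanti : ∀ x, Antitone (binary X x) := fun x => antitone_nat_of_succ_le (hX x)
  have hlim : ∃ f, IsLimitFun (binary X) f ∧ ∀ x, (∀ s, f x ≤ binary X x s) ∧
      ∃ s, f x = binary X x s := by
    have : ∀ x, ∃ v, (∀ᶠ s in Filter.atTop, binary X x s = v) ∧ (∀ s, v ≤ binary X x s) ∧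
        ∃ s, v = binary X x s := by
      intro x
      have hex : ∃ v, ∃ s, v = binary X x s := ⟨_, 0, rfl⟩
      have hmin : ∀ s, Nat.find hex ≤ binary X x s := fun s => Nat.find_min' hex ⟨s, rfl⟩
      obtain ⟨s, hs⟩ := Nat.find_spec hex
      refine ⟨Nat.find hex, ?_, hmin, s, hs⟩
      filter_upwards [Filter.eventually_ge_atTop s] with r hr
      exact le_antisymm ((hanti x hr).trans hs.ge) (hmin r)
    choose f hf using this
    exact ⟨f, fun x => (hf x).1, fun x => (hf x).2⟩
  obtain ⟨f, hf, hfmin⟩ := hlim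
  rw [computableFrom_iff_red] at hXC
  by_cases hinc : EventuallyIncreasing f
  · have hb : ComputableFrom C fun x => binary X x 0 := computableFrom_iff_red.2
      (hXC.comp (Red.of_primrec _ (Primrec₂.natPair.comp Primrec.id (Primrec.const 0))))
    obtain ⟨G, hG, hGA⟩ :=
      exists_isInfNonDecreasing hA ⟨_, hb, fun x => (hfmin x).1 0⟩ hinc
    exact ⟨G, ⟨f, hf, hG⟩, hGA⟩
  · simp only [EventuallyIncreasing, not_forall] at hinc
    have hy := Nat.find_spec hinc
    set y := Nat.find hinc
    have hbelow : {x | f x < y}.Finite :=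
      ((Set.finite_Iio y).biUnion (t := fun v => {x | f x = v})
        fun v hv => not_not.1 (Nat.find_min hinc hv)).subset fun x hx => by
          simp only [Set.mem_iUnion]
          exact ⟨f x, hx, rfl⟩
    obtain ⟨N, hN⟩ := hbelow.bddAbove
    have hinf : {x | ∃ s, X (Nat.pair x s) ≤ y}.Infinite :=
      Set.Infinite.mono (fun x (hx : f x = y) => by
        obtain ⟨s, hs⟩ := (hfmin x).2
        exact ⟨s, hs.symm.trans hx |>.le⟩) hy
    obtain ⟨G, hGinf, hGred, hG⟩ := exists_red_infinite_subset hinf (N + 1)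
    have hGy : ∀ x ∈ G, f x = y := by
      intro x hx
      obtain ⟨h1, s, hs⟩ := hG x hx
      refine le_antisymm (((hfmin x).1 s).trans hs) (not_lt.1 fun hlt => ?_)
      have : x ≤ N := hN hlt
      omega
    exact ⟨G, ⟨f, hf, hGinf, fun x hx z hz _ => (hGy x hx).trans (hGy z hz).symm |>.le⟩,
      fun i => (hA i).join_of_red (hXC.trans hGred)⟩

end NonDecr

theorem mainTheorem8 :
    (∀ (C : Set ℕ) (A : ℕ → Set ℕ), (∀ i, NonDecr.Hyperimmune C (A i)) →
      ∀ f : ℕ → ℕ, NonDecr.ComputablyBounded C f → NonDecr.EventuallyIncreasing f →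
        ∃ G : Set ℕ, NonDecr.IsInfNonDecreasing f G ∧
          ∀ i, NonDecr.Hyperimmune (NonDecr.join G C) (A i)) ∧
    NonDecr.ICNS.PreservesHyperimmunity ∧
    NonDecr.LNS.PreservesHyperimmunity :=
  ⟨fun _ _ hA _ hfb hf => NonDecr.exists_isInfNonDecreasing hA hfb hf,
    NonDecr.preservesHyperimmunity_ICNS, NonDecr.preservesHyperimmunity_LNS⟩
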